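/- **Theorem A.6.** Let $-1<\alpha<1$, $\beta>-1$, $0<\theta<1$ and $0<\theta+\alpha<1$. For real $n$ with $n-\theta\in\mathbb Z$ and $2n+\alpha+\beta+1>0$ define the (piecewise hypergeometric) perturbed Jacobi function $\Phi_n$ on $(0,\infty)$ by $$ \Phi_n(x)= \begin{cases} {}_2F_1\!\left[\begin{matrix}-n,\;n+\alpha+\beta+1\\ \beta+1\end{matrix};\,x\right], & 0<x<1,\\[2ex] \dfrac{\Gamma(\beta+1)\,\Gamma(n+1)}{\Gamma(-n-\alpha)\,\Gamma(2n+\alpha+\beta+2)}\;x^{-n-\beta-1}(x-1)^{-\alpha}\; {}_2F_1\!\left[\begin{matrix}n+1,\;n+\beta+1\\ 2n+\alpha+\beta+2\end{matrix};\,\dfrac1x\right], & x>1, \end{cases} $$ and let $$ w(x)= \begin{cases} x^\beta(1-x)^\alpha, & 0<x<1,\\[1ex] \dfrac{\sin(\pi\theta)}{\sin\pi(\alpha+\theta)}\;x^\beta(x-1)^\alpha, & x>1. \end{cases} $$ Then all these functions $\Phi_n$ lie in $L^2((0,\infty),w(x)\,dx)$; they are mutually orthogonal there, i.e. $\int_0^\infty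 \Phi_m(x)\Phi_n(x)\,w(x)\,dx=0$ for $m\ne n$; and $$ \int_0^\infty |\Phi_n(x)|^2\,w(x)\,dx= \frac{\Gamma(\beta+1)^2\,\Gamma(1+n)\,\Gamma(1+n+\alpha)}{(\alpha+\beta+2n+1)\,\Gamma(\beta+1+n)\,\Gamma(n+\alpha+\beta+1)} . $$ The system is not complete: the closed linear span of all the $\Phi_n$ is a proper subspace of $L^2((0,\infty),w(x)\,dx)$. -/

import Mathlib

open MeasureTheory Set

noncomputable section

namespace PerturbedJacobi

/-- The index set of the system: real numbers `n` with `n - θ ∈ ℤ` and `2n + α + β + 1 > 0`. -/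
def indexSet (α β θ : ℝ) : Set ℝ :=
  {n | (∃ k : ℤ, n - θ = k) ∧ 0 < 2 * n + α + β + 1}

/-- The perturbed Jacobi function `Φ_n` on the half-line `x > 0`, with `n` a (non-integer) real
number. The Gauss series are only used inside their disc of convergence; the value at the single
point `x = 1` is immaterial. -/
def Phi (α β n x : ℝ) : ℝ :=
  if x < 1 then
    ₂F₁ (-n) (n + α + β + 1) (β + 1) x
  else
    x ^ (-n - β - 1) * (x - 1) ^ (-α) *
      (Real.Gamma (β + 1) * Real.Gamma (n + 1) /
        (Real.Gamma (-n - α) * Real.Gamma (2 * n + α + β + 2))) *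
      ₂F₁ (n + 1) (n + β + 1) (2 * n + α + β + 2) (1 / x)

/-- The weight: `x^β (1-x)^α` on `(0,1)` and `(sin πθ / sin π(α+θ)) x^β (x-1)^α` on `(1,∞)`. -/
def weight (α β θ x : ℝ) : ℝ :=
  if x < 1 then
    x ^ β * (1 - x) ^ α
  else
    Real.sin (Real.pi * θ) / Real.sin (Real.pi * (α + θ)) * (x ^ β * (x - 1) ^ α)

/-- The measure `w(x) dx` on the half-line `(0,∞)`. -/
def weightMeasure (α β θ : ℝ) : Measure ℝ :=
  (volume.restrict (Ioi 0)).withDensity (fun x => ENNReal.ofReal (weight α β θ x))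

/-- The closed linear span in `L²((0,∞), w(x) dx)` of all the `Φ_n` with `n` in the index set. -/
def closedSpan (α β θ : ℝ) : Submodule ℂ (Lp ℂ 2 (weightMeasure α β θ)) :=
  (Submodule.span ℂ {f : Lp ℂ 2 (weightMeasure α β θ) | ∃ n ∈ indexSet α β θ,
    ∀ᵐ x ∂(weightMeasure α β θ), f x = (Phi α β n x : ℂ)}).topologicalClosure

end PerturbedJacobi

end

/-! On each of the intervals (0,1) and (1,∞) the function Φ_n solves a Sturm–Liouville equation with
eigenvalue λ_n = n(n+α+β+1). By Lagrange's identity, (λ_m − λ_n)∫Φ_mΦ_n w is a sum of boundary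
terms, and those at 0 and ∞ vanish. For α < 0 the function Φ_n has a finite limit at 1, and its
Gamma constant makes the two one-sided limits agree. What remains is the weighted jump
`matchingDefect` of the quasi-derivative (`eigenvalue_sub_mul_pairing`). The reflection formula
writes it as a Gamma factor times `matchingSine` (`matchingDefect_eq`), and the ratio in the weight
is exactly the one that makes this sine combination vanish on θ + ℤ. Orthogonality follows.

The identity also holds for m off the lattice. Dividing by m − n and letting m → n produces the
derivative of the sine factor, hence the norm. The limit may be taken because of the locally uniform
bound `exists_integrable_majorant`.

For α > 0 there is no finite limit at 1, but Euler's transformation is a symmetry (α, θ, n) ↦ (−α,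
θ+α, n+α) of the whole problem (`pairing_neg`). The case α = 0 is a limit α → 0 from the left.

Incompleteness rests on a sign. The λ_n are bounded below, while beyond 1 the operator with
eigenvalues λ_n has quadratic form −∫ p f'², which is not bounded below. If the Φ_n spanned a dense
subspace, they would form an orthogonal basis diagonalising this form on test functions, and a
sufficiently concentrated bump gives a contradiction.

The analytic inputs are `hypergeometric_euler` and the leading behaviour
`tendsto_one_sub_rpow_mul_hypergeometric` at 1. -/

open Filter Topology

namespace PerturbedJacobi

/-! ### The Gauss series: bounds, dependence on parameters, derivatives. -/

/-- The coefficients of the Gauss series, defined through their recursion. -/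
noncomputable def gaussCoeff (a b c : ℝ) : ℕ → ℝ
  | 0 => 1
  | k + 1 => gaussCoeff a b c k * ((a + k) * (b + k) / ((c + k) * (k + 1)))

theorem gaussCoeff_succ (a b c : ℝ) (k : ℕ) :
    gaussCoeff a b c (k + 1) =
      gaussCoeff a b c k * ((a + k) * (b + k) / ((c + k) * (k + 1))) := rfl

theorem gaussCoeff_eq (a b c : ℝ) (k : ℕ) :
    gaussCoeff a b c k = ordinaryHypergeometricCoefficient a b c k := by
  induction k with
  | zero => simp [gaussCoeff, ordinaryHypergeometricCoefficient]
  | succ k ih =>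
    rw [gaussCoeff_succ, ih]
    simp only [ordinaryHypergeometricCoefficient, ascPochhammer_succ_eval, Nat.factorial_succ]
    push_cast
    simp only [div_eq_mul_inv, mul_inv]
    ring

theorem gaussCoeff_mul_succ {c : ℝ} (hc : 0 < c) (a b : ℝ) (k : ℕ) :
    (c + k) * (k + 1) * gaussCoeff a b c (k + 1) = (a + k) * (b + k) * gaussCoeff a b c k := by
  rw [gaussCoeff_succ]
  have : c + k ≠ 0 := by positivity
  field_simp

theorem hypergeometric_eq_tsum (a b c x : ℝ) :
    ₂F₁ a b c x = ∑' k, gaussCoeff a b c k * x ^ k := by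
  rw [ordinaryHypergeometric_eq_tsum]
  exact tsum_congr fun k => by rw [gaussCoeff_eq, smul_eq_mul]

theorem hypergeometric_comm (a b c x : ℝ) : ₂F₁ a b c x = ₂F₁ b a c x := by
  simp only [ordinaryHypergeometric, ordinaryHypergeometricSeries_symm a b c]

theorem gaussCoeff_pos {s : ℝ} (hs : 0 < s) (k : ℕ) : 0 < gaussCoeff s 1 1 k := by
  induction k with
  | zero => simp [gaussCoeff]
  | succ k ih => rw [gaussCoeff_succ]; positivity

/-- With b = c = 1 the coefficients reduce to (s)_k/k!, those of the binomial series. For s > 0 they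
are positive and serve as the scale against which all other Gauss series are measured. -/
theorem hasSum_binomial (s : ℝ) {x : ℝ} (hx : |x| < 1) :
    HasSum (fun k => gaussCoeff s 1 1 k * x ^ k) ((1 - x) ^ (-s)) := by
  have h := (Real.one_add_rpow_hasFPowerSeriesOnBall_zero (a := -s)).hasSum (y := -x) (by
    rw [← ENNReal.ofReal_one, Metric.eball_ofReal]; simpa using hx)
  rw [binomialSeries_eq_ordinaryHypergeometricSeries (b := (1 : ℝ))
    (fun k => by have : (0 : ℝ) ≤ k := k.cast_nonneg; linarith)] at h
  convert! h using 1
  · ext k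
    rw [gaussCoeff_eq, ← smul_eq_mul, ← ordinaryHypergeometricSeries_apply_eq s 1 1 x k, neg_neg]
    simp only [FormalMultilinearSeries.compContinuousLinearMap_apply, Function.comp_def]
    simp
  · simp [sub_eq_add_neg]

/-- Locally uniform comparison of the Gauss series with a binomial series. -/
theorem exists_gaussCoeff_le {a₀ b₀ c₀ s : ℝ} (hc : 0 < c₀) (hs : 0 < s)
    (h : a₀ + b₀ - c₀ < s) :
    ∃ C, 0 < C ∧ ∀ᶠ p : ℝ × ℝ × ℝ in 𝓝 (a₀, b₀, c₀), 0 < p.2.2 ∧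
      ∀ k, |gaussCoeff p.1 p.2.1 p.2.2 k| ≤ C * gaussCoeff s 1 1 k := by
  -- From index J on, the coefficient ratio is at most that of the binomial series: (s+k)(c+k) −
  -- (a+k)(b+k) = k(c+s−a−b) + sc − ab, and the gap c+s−a−b stays at least (s−(a₀+b₀−c₀))/2 near the
  -- base point.
  obtain ⟨J, hJ⟩ := exists_nat_ge (max (max (|a₀| + 1) (|b₀| + 1))
    ((|a₀| + 1) * (|b₀| + 1) / ((s - (a₀ + b₀ - c₀)) / 2)))
  simp only [max_le_iff] at hJ
  obtain ⟨⟨hJa, hJb⟩, hJη⟩ := hJ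
  have hη : 0 < (s - (a₀ + b₀ - c₀)) / 2 := by linarith
  rw [div_le_iff₀ hη] at hJη
  set A := |a₀| + 1 with hA
  set B := |b₀| + 1 with hB
  have hA0 : 0 < A := by positivity
  have hB0 : 0 < B := by positivity
  -- Each of the first J steps loses at most a factor R against the binomial ratio, later steps lose
  -- nothing; hence the constant R^J.
  set R := max 1 ((A + J) * (B + J) / (c₀ / 2) / s) with hR
  have hR1 : 1 ≤ R := le_max_left _ _
  refine ⟨R ^ J, by positivity, ?_⟩
  have e1 : ∀ᶠ p : ℝ × ℝ × ℝ in 𝓝 (a₀, b₀, c₀), |p.1| < A :=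
    (ContinuousAt.tendsto (f := fun p : ℝ × ℝ × ℝ => |p.1|) (by fun_prop)).eventually_lt_const
      (by simp [hA])
  have e2 : ∀ᶠ p : ℝ × ℝ × ℝ in 𝓝 (a₀, b₀, c₀), |p.2.1| < B :=
    (ContinuousAt.tendsto (f := fun p : ℝ × ℝ × ℝ => |p.2.1|) (by fun_prop)).eventually_lt_const
      (by simp [hB])
  have e3 : ∀ᶠ p : ℝ × ℝ × ℝ in 𝓝 (a₀, b₀, c₀), c₀ / 2 < p.2.2 :=
    (ContinuousAt.tendsto (f := fun p : ℝ × ℝ × ℝ => p.2.2) (by fun_prop)).eventually_const_lt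
      (by simp [hc])
  have e4 : ∀ᶠ p : ℝ × ℝ × ℝ in 𝓝 (a₀, b₀, c₀),
      p.1 + p.2.1 - p.2.2 < s - (s - (a₀ + b₀ - c₀)) / 2 :=
    (ContinuousAt.tendsto (f := fun p : ℝ × ℝ × ℝ => p.1 + p.2.1 - p.2.2)
      (by fun_prop)).eventually_lt_const (by simp only; linarith)
  filter_upwards [e1, e2, e3, e4] with ⟨a, b, c⟩ ha hb hc' hs'
  simp only at ha hb hc' hs'
  have hcp : 0 < c := by linarith
  refine ⟨hcp, fun k => ?_⟩
  have ha' := abs_lt.1 ha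
  have hb' := abs_lt.1 hb
  suffices H : |gaussCoeff a b c k| ≤ R ^ (min k J) * gaussCoeff s 1 1 k from
    H.trans (mul_le_mul_of_nonneg_right (pow_le_pow_right₀ hR1 (min_le_right _ _))
      (gaussCoeff_pos hs k).le)
  induction k with
  | zero => simp [gaussCoeff]
  | succ k ih =>
    have hk : (0 : ℝ) ≤ k := k.cast_nonneg
    have hck : 0 < c + k := by positivity
    rw [gaussCoeff_succ, gaussCoeff_succ, abs_mul, abs_div, abs_mul,
      abs_of_pos (by positivity : 0 < (c + k) * ((k : ℝ) + 1))]
    have step : |a + k| * |b + k| / ((c + k) * (k + 1)) * R ^ (min k J) ≤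
        R ^ (min (k + 1) J) * ((s + k) * (1 + k) / ((1 + k) * (k + 1))) := by
      have hk1 : (0 : ℝ) < k + 1 := by positivity
      rw [div_mul_eq_mul_div, div_le_iff₀ (by positivity),
        show R ^ (min (k + 1) J) * ((s + k) * (1 + k) / ((1 + k) * (k + 1))) *
          ((c + k) * (k + 1)) = R ^ (min (k + 1) J) * ((s + k) * (c + k)) by field_simp]
      rcases le_or_gt J k with hJk | hJk
      · rw [min_eq_right hJk, min_eq_right (hJk.trans (Nat.le_succ _)), mul_comm]
        refine mul_le_mul_of_nonneg_left ?_ (by positivity)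
        have hJk' : (J : ℝ) ≤ k := by exact_mod_cast hJk
        rw [abs_of_nonneg (by linarith), abs_of_nonneg (by linarith)]
        have h1 : a * b ≤ A * B := by
          refine (le_abs_self _).trans ?_
          rw [abs_mul]
          exact mul_le_mul ha.le hb.le (abs_nonneg _) hA0.le
        have h2 : A * B ≤ k * ((s - (a₀ + b₀ - c₀)) / 2) :=
          hJη.trans (mul_le_mul_of_nonneg_right hJk' hη.le)
        have h3 : k * ((s - (a₀ + b₀ - c₀)) / 2) ≤ k * (c + s - a - b) :=
          mul_le_mul_of_nonneg_left (by linarith) hk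
        nlinarith [mul_pos hcp hs]
      · rw [min_eq_left hJk.le, min_eq_left hJk, pow_succ]
        have hJk' : (k : ℝ) ≤ J := by exact_mod_cast hJk.le
        have h1 : |a + k| ≤ A + J := (abs_add_le _ _).trans (by rw [Nat.abs_cast]; linarith)
        have h2 : |b + k| ≤ B + J := (abs_add_le _ _).trans (by rw [Nat.abs_cast]; linarith)
        have h3 : |a + k| * |b + k| ≤ R * ((s + k) * (c + k)) := by
          calc |a + k| * |b + k| ≤ (A + J) * (B + J) :=
                mul_le_mul h1 h2 (abs_nonneg _) (by positivity)
            _ = (A + J) * (B + J) / (c₀ / 2) / s * (s * (c₀ / 2)) := by field_simp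
            _ ≤ R * ((s + k) * (c + k)) := by
                refine mul_le_mul (le_max_right _ _) ?_ (by positivity) (by positivity)
                exact mul_le_mul (by linarith) (by linarith) (by positivity) (by positivity)
        calc |a + k| * |b + k| * R ^ k ≤ R * ((s + k) * (c + k)) * R ^ k :=
              mul_le_mul_of_nonneg_right h3 (by positivity)
          _ = _ := by ring
    calc _ ≤ R ^ (min k J) * gaussCoeff s 1 1 k * (|a + k| * |b + k| / ((c + k) * (k + 1))) :=
          mul_le_mul_of_nonneg_right ih (by positivity)
      _ = gaussCoeff s 1 1 k * (|a + k| * |b + k| / ((c + k) * (k + 1)) * R ^ (min k J)) := by ring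
      _ ≤ _ := mul_le_mul_of_nonneg_left step (gaussCoeff_pos hs k).le
      _ = _ := by ring

/-- Locally uniform bound for the Gauss hypergeometric function near the singular point `1`. -/
theorem exists_hypergeometric_le {a₀ b₀ c₀ s : ℝ} (hc : 0 < c₀) (hs : 0 < s)
    (h : a₀ + b₀ - c₀ < s) :
    ∃ C, 0 < C ∧ ∀ᶠ p : ℝ × ℝ × ℝ in 𝓝 (a₀, b₀, c₀),
      ∀ x : ℝ, 0 ≤ x → x < 1 → |₂F₁ p.1 p.2.1 p.2.2 x| ≤ C * (1 - x) ^ (-s) := by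
  obtain ⟨C, hC, H⟩ := exists_gaussCoeff_le hc hs h
  refine ⟨C, hC, H.mono fun p hp x hx hx1 => ?_⟩
  rw [hypergeometric_eq_tsum, ← Real.norm_eq_abs]
  refine tsum_of_norm_bounded ((hasSum_binomial s (by rwa [abs_of_nonneg hx])).mul_left C) ?_
  intro k
  rw [Real.norm_eq_abs, abs_mul, abs_of_nonneg (pow_nonneg hx k), ← mul_assoc]
  exact mul_le_mul_of_nonneg_right (hp.2 k) (pow_nonneg hx k)

/-- Continuity of the Gauss hypergeometric function in its parameters. -/
theorem continuousAt_hypergeometric_params (a₀ b₀ : ℝ) {c₀ x : ℝ} (hc : 0 < c₀) (hx : |x| < 1) :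
    ContinuousAt (fun p : ℝ × ℝ × ℝ => ₂F₁ p.1 p.2.1 p.2.2 x) (a₀, b₀, c₀) := by
  -- Any positive exponent above a₀+b₀−c₀ will do, since |x| stays away from 1.
  obtain ⟨C, hC, H⟩ := exists_gaussCoeff_le (a₀ := a₀) (b₀ := b₀) hc
    (lt_max_of_lt_left one_pos : 0 < max 1 (a₀ + b₀ - c₀ + 1)) (lt_max_of_lt_right (by linarith))
  simp only [ContinuousAt, hypergeometric_eq_tsum]
  have hx' : |(|x|)| < 1 := by rwa [abs_abs]
  refine tendsto_tsum_of_dominated_convergence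
    ((hasSum_binomial (max 1 (a₀ + b₀ - c₀ + 1)) hx').mul_left C).summable ?_ ?_
  · intro k
    refine Tendsto.mul_const _ ?_
    induction k with
    | zero => simp [gaussCoeff]
    | succ k ih =>
      have : c₀ + k ≠ 0 := by positivity
      refine ih.mul (ContinuousAt.tendsto (f := fun p : ℝ × ℝ × ℝ =>
        (p.1 + k) * (p.2.1 + k) / ((p.2.2 + k) * (k + 1))) ?_)
      exact ContinuousAt.div (by fun_prop) (by fun_prop) (by positivity)
  · filter_upwards [H] with p hp k
    rw [Real.norm_eq_abs, abs_mul, abs_pow, ← mul_assoc]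
    exact mul_le_mul_of_nonneg_right (hp.2 k) (by positivity)

theorem summable_gaussCoeff {c x : ℝ} (a b : ℝ) (hc : 0 < c) (hx : |x| < 1) :
    Summable fun k => ‖gaussCoeff a b c k * x ^ k‖ := by
  obtain ⟨C, hC, H⟩ := exists_gaussCoeff_le (a₀ := a) (b₀ := b) hc
    (lt_max_of_lt_left one_pos : 0 < max 1 (a + b - c + 1)) (lt_max_of_lt_right (by linarith))
  have hx' : |(|x|)| < 1 := by rwa [abs_abs]
  refine Summable.of_nonneg_of_le (fun k => norm_nonneg _) (fun k => ?_)
    ((hasSum_binomial (max 1 (a + b - c + 1)) hx').mul_left C).summable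
  rw [Real.norm_eq_abs, abs_mul, abs_pow, ← mul_assoc]
  exact mul_le_mul_of_nonneg_right (H.self_of_nhds.2 k) (by positivity)

theorem hasSum_gaussCoeff {c x : ℝ} (a b : ℝ) (hc : 0 < c) (hx : |x| < 1) :
    HasSum (fun k => gaussCoeff a b c k * x ^ k) (₂F₁ a b c x) := by
  rw [hypergeometric_eq_tsum]
  exact (summable_gaussCoeff a b hc hx).of_norm.hasSum

/-- Coefficient form of F' = (ab/c) F(a+1, b+1; c+1). -/
theorem succ_mul_gaussCoeff_succ {c : ℝ} (hc : 0 < c) (a b : ℝ) (k : ℕ) :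
    (k + 1) * gaussCoeff a b c (k + 1) = a * b / c * gaussCoeff (a + 1) (b + 1) (c + 1) k := by
  induction k with
  | zero => simp [gaussCoeff]
  | succ k ih =>
    have h1 : c + k + 1 ≠ 0 := by positivity
    have h2 : c ≠ 0 := by positivity
    have h3 : (k : ℝ) + 1 ≠ 0 := by positivity
    have h4 : (k : ℝ) + 1 + 1 ≠ 0 := by positivity
    rw [gaussCoeff_succ a b c (k + 1), gaussCoeff_succ (a + 1)]
    push_cast
    have h5 : c + (k + 1) ≠ 0 := by positivity
    have h6 : c + 1 + k ≠ 0 := by positivity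
    calc _ = (k + 1) * gaussCoeff a b c (k + 1) *
          ((a + (k + 1)) * (b + (k + 1)) / ((c + (k + 1)) * (k + 1))) := by
          field_simp
      _ = _ := by
          rw [ih, show c + 1 + (k : ℝ) = c + (k + 1) by ring]
          ring

/-- Coefficient form of the contiguity relation (x d/dx + a)F = a F(a+1); the next lemma is its
analogue (x d/dx + c)F(c+1) = c F(c). -/
theorem add_mul_gaussCoeff (a b c : ℝ) (k : ℕ) :
    (a + k) * gaussCoeff a b c k = a * gaussCoeff (a + 1) b c k := by
  induction k with
  | zero => simp [gaussCoeff]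
  | succ k ih =>
    rw [gaussCoeff_succ, gaussCoeff_succ]
    push_cast
    calc _ = (a + k) * gaussCoeff a b c k *
          ((a + 1 + k) * (b + k) / ((c + k) * (k + 1))) := by ring
      _ = _ := by rw [ih]; ring

theorem add_mul_gaussCoeff_lower {c : ℝ} (hc : 0 < c) (a b : ℝ) (k : ℕ) :
    (c + k) * gaussCoeff a b (c + 1) k = c * gaussCoeff a b c k := by
  induction k with
  | zero => simp [gaussCoeff]
  | succ k ih =>
    have h1 : c + k ≠ 0 := by positivity
    have h2 : c + 1 + k ≠ 0 := by positivity
    have h3 : (k : ℝ) + 1 ≠ 0 := by positivity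
    rw [gaussCoeff_succ, gaussCoeff_succ]
    push_cast
    calc _ = (c + k) * gaussCoeff a b (c + 1) k *
          ((a + k) * (b + k) / ((c + k) * (k + 1))) := by
          rw [show c + ((k : ℝ) + 1) = c + 1 + k by ring]; field_simp
      _ = _ := by rw [ih]; ring

theorem hasSum_index_mul_gaussCoeff {c x : ℝ} (a b : ℝ) (hc : 0 < c) (hx : |x| < 1) :
    HasSum (fun k : ℕ => k * gaussCoeff a b c k * x ^ k)
      (x * (a * b / c * ₂F₁ (a + 1) (b + 1) (c + 1) x)) := by
  rw [← hasSum_nat_add_iff' 1]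
  simp only [Finset.range_one, Finset.sum_singleton, Nat.cast_zero, zero_mul, sub_zero]
  convert! ((hasSum_gaussCoeff (a + 1) (b + 1) (by positivity : 0 < c + 1) hx).mul_left
    (x * (a * b / c))) using 1
  · ext k
    have := succ_mul_gaussCoeff_succ hc a b k
    push_cast
    rw [this]
    ring
  · ring

theorem hasDerivAt_hypergeometric {c x : ℝ} (a b : ℝ) (hc : 0 < c) (hx : |x| < 1) :
    HasDerivAt (fun y : ℝ => ₂F₁ a b c y) (a * b / c * ₂F₁ (a + 1) (b + 1) (c + 1) x) x := by
  -- On (−r, r) the termwise derivatives are dominated by their absolute values at r, which are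
  -- summable because r < 1.
  obtain ⟨r, hxr, hr⟩ := exists_between hx
  have hr0 : 0 < r := (abs_nonneg x).trans_lt hxr
  have hr' : |r| < 1 := by rwa [abs_of_pos hr0]
  simp only [hypergeometric_eq_tsum a b c]
  have key : HasDerivAt (fun y : ℝ => ∑' k, gaussCoeff a b c k * y ^ k)
      (∑' k : ℕ, gaussCoeff a b c k * (k * x ^ (k - 1))) x := by
    refine hasDerivAt_tsum_of_isPreconnected (u := fun k : ℕ =>
      |gaussCoeff a b c k * (k * r ^ (k - 1))|) ?_ isOpen_Ioo (isPreconnected_Ioo (a := -r) (b := r))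
      (fun k y _ => (hasDerivAt_pow k y).const_mul _) ?_ (y₀ := 0) ?_ ?_ ?_
    · rw [← summable_nat_add_iff 1]
      convert! (summable_gaussCoeff (a + 1) (b + 1) (by positivity : 0 < c + 1) hr').mul_left
        (|a * b / c|) using 1
      ext k
      rw [Real.norm_eq_abs, ← abs_mul, ← mul_assoc, ← mul_assoc,
        ← succ_mul_gaussCoeff_succ hc a b k]
      push_cast
      congr 1
      ring
    · intro k y hy
      have hyr : |y| ≤ r := (abs_lt.2 hy).le
      rw [Real.norm_eq_abs, abs_mul, abs_mul, abs_mul, abs_mul]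
      rw [abs_pow, abs_pow, abs_of_pos hr0]
      gcongr
    · simp [hr0]
    · exact (hasSum_gaussCoeff a b hc (by simp)).summable
    · exact abs_lt.1 hxr
  convert! key using 1
  rw [hypergeometric_eq_tsum, ← tsum_mul_left]
  have hs : Summable (fun k : ℕ => gaussCoeff a b c k * (k * x ^ (k - 1))) := by
    rw [← summable_nat_add_iff 1]
    convert! ((hasSum_gaussCoeff (a + 1) (b + 1) (by positivity : 0 < c + 1) hx).mul_left
      (a * b / c)).summable using 1
    ext k
    rw [← mul_assoc, ← mul_assoc, ← succ_mul_gaussCoeff_succ hc a b k]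
    push_cast
    ring
  rw [hs.tsum_eq_zero_add]
  simp only [Nat.cast_zero, zero_mul, mul_zero, zero_add]
  refine tsum_congr fun k => ?_
  rw [← mul_assoc, ← mul_assoc, ← succ_mul_gaussCoeff_succ hc a b k]
  push_cast
  ring

theorem continuousAt_hypergeometric {c x : ℝ} (a b : ℝ) (hc : 0 < c) (hx : |x| < 1) :
    ContinuousAt (fun y : ℝ => ₂F₁ a b c y) x :=
  (hasDerivAt_hypergeometric a b hc hx).continuousAt

theorem hypergeometric_raise_left {c x : ℝ} (a b : ℝ) (hc : 0 < c) (hx : |x| < 1) :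
    a * ₂F₁ a b c x + x * (a * b / c * ₂F₁ (a + 1) (b + 1) (c + 1) x) =
      a * ₂F₁ (a + 1) b c x := by
  refine (((hasSum_gaussCoeff a b hc hx).mul_left a).add
    (hasSum_index_mul_gaussCoeff a b hc hx)).unique ?_
  convert! (hasSum_gaussCoeff (a + 1) b hc hx).mul_left a using 1
  ext k
  linear_combination x ^ k * add_mul_gaussCoeff a b c k

theorem hypergeometric_lower {c x : ℝ} (a b : ℝ) (hc : 0 < c) (hx : |x| < 1) :
    c * ₂F₁ a b (c + 1) x + x * (a * b / (c + 1) * ₂F₁ (a + 1) (b + 1) (c + 1 + 1) x) =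
      c * ₂F₁ a b c x := by
  have hc1 : 0 < c + 1 := by positivity
  refine (((hasSum_gaussCoeff a b hc1 hx).mul_left c).add
    (hasSum_index_mul_gaussCoeff a b hc1 hx)).unique ?_
  convert! (hasSum_gaussCoeff a b hc hx).mul_left c using 1
  ext k
  linear_combination x ^ k * add_mul_gaussCoeff_lower hc a b k

/-- The contiguity relation in c, in the form needed to differentiate the quasi-derivative on (0,1).
-/
theorem hasDerivAt_rpow_mul_hypergeometric {c x : ℝ} (a b : ℝ) (hc : 0 < c) (hx0 : 0 < x)
    (hx : x < 1) :
    HasDerivAt (fun y : ℝ => y ^ c * ₂F₁ a b (c + 1) y) (c * x ^ (c - 1) * ₂F₁ a b c x) x := by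
  have hx' : |x| < 1 := by rwa [abs_of_pos hx0]
  have h := (Real.hasDerivAt_rpow_const (p := c) (Or.inl hx0.ne')).mul
    (hasDerivAt_hypergeometric a b (by positivity : 0 < c + 1) hx')
  refine h.congr_deriv ?_
  have e : x ^ c = x ^ (c - 1) * x := by
    rw [← Real.rpow_add_one hx0.ne']; ring_nf
  rw [e]
  linear_combination x ^ (c - 1) * hypergeometric_lower a b hc hx'

/-- The contiguity relation in a, read at 1/x. On (1,∞) it differentiates both Φ_n and its
quasi-derivative. -/
theorem hasDerivAt_rpow_mul_hypergeometric_inv {c x : ℝ} (a b : ℝ) (hc : 0 < c) (hx : 1 < x) :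
    HasDerivAt (fun y : ℝ => y ^ (-a) * ₂F₁ a b c (1 / y))
      (-a * x ^ (-a - 1) * ₂F₁ (a + 1) b c (1 / x)) x := by
  have hx0 : 0 < x := by linarith
  have hx' : |1 / x| < 1 := by
    rw [abs_of_pos (by positivity), div_lt_one hx0]; exact hx
  have hinv : HasDerivAt (fun y : ℝ => 1 / y) (-(x ^ 2)⁻¹) x := by
    simpa [one_div] using hasDerivAt_inv hx0.ne'
  have h := (Real.hasDerivAt_rpow_const (p := -a) (Or.inl hx0.ne')).mul
    ((hasDerivAt_hypergeometric a b hc hx').comp x hinv)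
  refine h.congr_deriv ?_
  have e : x ^ (-a) = x ^ (-a - 1) * x := by
    rw [← Real.rpow_add_one hx0.ne']; ring_nf
  rw [e]
  have h2 := hypergeometric_raise_left a b hc hx'
  have e2 : (x ^ 2)⁻¹ = 1 / x * (1 / x) := by field_simp
  have e3 : x * (1 / x) = 1 := by field_simp
  simp only [Function.comp_apply]
  rw [e2]
  linear_combination (-x ^ (-a - 1)) * h2 - x ^ (-a - 1) * (1 / x) *
    (a * b / c * ₂F₁ (a + 1) (b + 1) (c + 1) (1 / x)) * e3

/-! ### Euler's transformation through formal power series. -/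

section Euler

open PowerSeries

/-- The Euler operator `X d/dX` on formal power series. -/
noncomputable def eulerOp (f : PowerSeries ℝ) : PowerSeries ℝ := X * d⁄dX ℝ f

theorem coeff_eulerOp (f : PowerSeries ℝ) (k : ℕ) : coeff k (eulerOp f) = k * coeff k f := by
  cases k with
  | zero => simp [eulerOp]
  | succ k =>
    rw [eulerOp, coeff_succ_X_mul, coeff_derivative]
    push_cast
    ring

theorem eulerOp_mul (f g : PowerSeries ℝ) :
    eulerOp (f * g) = eulerOp f * g + f * eulerOp g := by
  simp only [eulerOp, Derivation.leibniz, smul_eq_mul]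
  ring

theorem eulerOp_add (f g : PowerSeries ℝ) : eulerOp (f + g) = eulerOp f + eulerOp g := by
  simp only [eulerOp, map_add, mul_add]

/-- The hypergeometric equation written with ϑ = X d/dX is, coefficient by coefficient, the two-term
recursion. As c > 0 the factor (c+k)(k+1) never vanishes, so the constant term determines the
solution. -/
theorem coeff_eq_gaussCoeff_iff {c : ℝ} (hc : 0 < c) (a b : ℝ) (f : PowerSeries ℝ) :
    eulerOp (eulerOp f) + C (c - 1) * eulerOp f =
      X * (eulerOp (eulerOp f) + C (a + b) * eulerOp f + C (a * b) * f) ↔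
    ∀ k, coeff k f = coeff 0 f * gaussCoeff a b c k := by
  have hrec : eulerOp (eulerOp f) + C (c - 1) * eulerOp f =
      X * (eulerOp (eulerOp f) + C (a + b) * eulerOp f + C (a * b) * f) ↔
      ∀ k : ℕ, (c + k) * (k + 1) * coeff (k + 1) f = (a + k) * (b + k) * coeff k f := by
    rw [PowerSeries.ext_iff]
    constructor
    · intro h k
      have := h (k + 1)
      simp only [map_add (coeff _), coeff_eulerOp, coeff_C_mul, coeff_succ_X_mul] at this
      push_cast at this
      linear_combination this
    · rintro h (_ | k)
      · simp only [map_add (coeff _), coeff_eulerOp, coeff_C_mul]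
        simp
      · have := h k
        simp only [map_add (coeff _), coeff_eulerOp, coeff_C_mul, coeff_succ_X_mul]
        push_cast
        linear_combination this
  rw [hrec]
  constructor
  · intro h k
    induction k with
    | zero => simp [gaussCoeff]
    | succ k ih =>
      have h1 : (c + k) * (k + 1) ≠ 0 := by positivity
      refine mul_left_cancel₀ h1 ?_
      rw [h k, ih]
      linear_combination (-coeff 0 f) * gaussCoeff_mul_succ hc a b k
  · intro h k
    rw [h (k + 1), h k]
    linear_combination coeff 0 f * gaussCoeff_mul_succ hc a b k

/-- The product of F(a,b;c) with the binomial series of exponent −(c−a−b) solves the hypergeometric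
equation with parameters c−a, c−b, c and has constant term 1, so uniqueness identifies it. -/
theorem gaussCoeff_euler {c : ℝ} (hc : 0 < c) (a b : ℝ) (k : ℕ) :
    ∑ p ∈ Finset.HasAntidiagonal.antidiagonal k, gaussCoeff (c - a - b) 1 1 p.1 * gaussCoeff a b c p.2 =
      gaussCoeff (c - a) (c - b) c k := by
  set f : PowerSeries ℝ := PowerSeries.mk (gaussCoeff a b c) with hf
  set g : PowerSeries ℝ := PowerSeries.mk (gaussCoeff (c - a - b) 1 1) with hg
  have ef : eulerOp (eulerOp f) + C (c - 1) * eulerOp f =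
      X * (eulerOp (eulerOp f) + C (a + b) * eulerOp f + C (a * b) * f) := by
    rw [coeff_eq_gaussCoeff_iff hc]
    intro k
    simp [hf, gaussCoeff]
  have e1 : (1 - X) * eulerOp g = C (c - a - b) * X * g := by
    ext (_ | k)
    · have := coeff_eulerOp g 0
      simp only [coeff_zero_eq_constantCoeff] at this
      simp [sub_mul, mul_assoc, this]
    · rw [sub_mul, one_mul, mul_assoc, map_sub, coeff_C_mul, coeff_succ_X_mul, coeff_succ_X_mul,
        coeff_eulerOp, coeff_eulerOp, hg, coeff_mk, coeff_mk]
      have := gaussCoeff_mul_succ one_pos (c - a - b) 1 k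
      push_cast
      have h0 : (1 : ℝ) + k ≠ 0 := by positivity
      refine mul_left_cancel₀ h0 ?_
      linear_combination this
  have eX : eulerOp (X : PowerSeries ℝ) = X := by simp [eulerOp]
  have eC (r : ℝ) : eulerOp (C r) = 0 := by simp [eulerOp]
  have e2 : (1 - X) * eulerOp (eulerOp g) - X * eulerOp g =
      C (c - a - b) * X * g + C (c - a - b) * X * eulerOp g := by
    have h := congrArg eulerOp e1
    have e1' : eulerOp (1 - X : PowerSeries ℝ) = -X := by simp [eulerOp]
    rw [eulerOp_mul, eulerOp_mul, eulerOp_mul, eX, eC, e1'] at h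
    linear_combination h
  have key : eulerOp (eulerOp (g * f)) + C (c - 1) * eulerOp (g * f) =
      X * (eulerOp (eulerOp (g * f)) + C ((c - a) + (c - b)) * eulerOp (g * f) +
        C ((c - a) * (c - b)) * (g * f)) := by
    have hX : (1 - X : PowerSeries ℝ) ≠ 0 := by
      intro h
      have := congrArg (coeff 0) h
      simp at this
    -- The binomial factor g is known through (1−X)ϑg = (c−a−b)Xg and the ϑ-derivative of this
    -- relation, so the equation is verified after multiplication by 1−X.
    refine mul_left_cancel₀ hX ?_
    simp only [eulerOp_mul, eulerOp_add]
    simp only [map_sub, map_add, map_mul, map_one] at ef e1 e2 ⊢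
    linear_combination (1 - X) * g * ef + (1 - X) * f * e2 +
      ((1 + C c - C a - C b) * X * f + 2 * (1 - X) * eulerOp f +
        (C c - 1 - (2 * C c - C a - C b) * X) * f) * e1
  rw [coeff_eq_gaussCoeff_iff hc] at key
  have h := key k
  rw [coeff_mul, coeff_mul] at h
  simpa [hf, hg, gaussCoeff] using h

end Euler

/-- Euler's transformation of the Gauss hypergeometric function. -/
theorem hypergeometric_euler {c x : ℝ} (a b : ℝ) (hc : 0 < c) (hx0 : 0 ≤ x) (hx : x < 1) :
    ₂F₁ a b c x = (1 - x) ^ (c - a - b) * ₂F₁ (c - a) (c - b) c x := by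
  have hx' : |x| < 1 := by rwa [abs_of_nonneg hx0]
  have hmul : (1 - x) ^ (-(c - a - b)) * ₂F₁ a b c x = ₂F₁ (c - a) (c - b) c x := by
    rw [← (hasSum_binomial (c - a - b) hx').tsum_eq, hypergeometric_eq_tsum a b c,
      tsum_mul_tsum_eq_tsum_sum_antidiagonal_of_summable_norm
        (summable_gaussCoeff _ _ one_pos hx') (summable_gaussCoeff a b hc hx'),
      hypergeometric_eq_tsum]
    refine tsum_congr fun k => ?_
    rw [← gaussCoeff_euler hc a b k, Finset.sum_mul]
    refine Finset.sum_congr rfl fun p hp => ?_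
    rw [← Finset.HasAntidiagonal.mem_antidiagonal.1 hp, pow_add]
    ring
  rw [← hmul, ← mul_assoc, ← Real.rpow_add (by linarith)]
  simp

/-! ### Leading behaviour at the singular point 1. -/

/-- Comparison of two power series at the boundary point `1`. -/
theorem tendsto_tsum_div_tsum {d e : ℕ → ℝ} {L : ℝ} (he : ∀ k, 0 < e k)
    (hd' : ∀ x ∈ Ioo (0 : ℝ) 1, Summable fun k => d k * x ^ k)
    (he' : ∀ x ∈ Ioo (0 : ℝ) 1, Summable fun k => e k * x ^ k)
    (hL : Tendsto (fun k => d k / e k) atTop (𝓝 L))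
    (hE : Tendsto (fun x : ℝ => ∑' k, e k * x ^ k) (𝓝[<] 1) atTop) :
    Tendsto (fun x : ℝ => (∑' k, d k * x ^ k) / ∑' k, e k * x ^ k) (𝓝[<] 1) (𝓝 L) := by
  rw [Metric.tendsto_nhds]
  intro ε hε
  -- The terms before K contribute at most the constant M, negligible because the denominator tends
  -- to infinity; the later ones obey the ratio bound.
  obtain ⟨K, hK⟩ := eventually_atTop.1 (Metric.tendsto_nhds.1 hL (ε / 3) (by positivity))
  set M := ∑ k ∈ Finset.range K, |d k - L * e k| with hM
  filter_upwards [hE.eventually_gt_atTop (M / (ε / 3)), hE.eventually_gt_atTop 0,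
    Ioo_mem_nhdsLT (zero_lt_one' ℝ)] with x hxM hx0 hx
  set D := ∑' k, d k * x ^ k
  set E := ∑' k, e k * x ^ k
  have h1 : |D - L * E| ≤ M + ε / 3 * E := by
    have hs : HasSum (fun k => d k * x ^ k - L * (e k * x ^ k)) (D - L * E) :=
      (hd' x hx).hasSum.sub ((he' x hx).hasSum.mul_left L)
    have hm : HasSum (fun k => (if k ∈ Finset.range K then |d k - L * e k| else 0) +
        ε / 3 * (e k * x ^ k)) (M + ε / 3 * E) := by
      refine HasSum.add ?_ ((he' x hx).hasSum.mul_left _)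
      rw [hM, Finset.sum_congr rfl fun k hk => (if_pos hk).symm]
      exact hasSum_sum_of_ne_finset_zero fun k hk => if_neg hk
    rw [← hs.tsum_eq, ← Real.norm_eq_abs]
    refine tsum_of_norm_bounded hm fun k => ?_
    have hxk : 0 < x ^ k := pow_pos hx.1 k
    have hxk1 : x ^ k ≤ 1 := pow_le_one₀ hx.1.le hx.2.le
    rw [show d k * x ^ k - L * (e k * x ^ k) = (d k - L * e k) * x ^ k by ring, Real.norm_eq_abs,
      abs_mul, abs_of_pos hxk]
    split_ifs with hk
    · have : 0 ≤ ε / 3 * (e k * x ^ k) := by have := he k; positivity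
      nlinarith [abs_nonneg (d k - L * e k)]
    · have := hK k (by simpa using hk)
      rw [Real.dist_eq, div_sub' (he k).ne', abs_div, abs_of_pos (he k), div_lt_iff₀ (he k),
        mul_comm (e k)] at this
      nlinarith
  rw [Real.dist_eq, div_sub' hx0.ne', abs_div, abs_of_pos hx0, div_lt_iff₀ hx0, mul_comm E]
  rw [div_lt_iff₀ (by positivity)] at hxM
  nlinarith

/-- Both coefficients are quotients of finite products that occur in Euler's limit for Γ. The
factorials cancel, and the powers of n cancel because c + s = a + b. -/
theorem gaussCoeff_succ_div (a b : ℝ) {c s : ℝ} (n : ℕ) (hn : n ≠ 0) (hc : 0 < c)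
    (hs : s = a + b - c) (hs0 : 0 < s) (ha : ∀ k : ℕ, a + k ≠ 0) (hb : ∀ k : ℕ, b + k ≠ 0) :
    gaussCoeff a b c (n + 1) / gaussCoeff s 1 1 (n + 1) =
      Real.GammaSeq c n * Real.GammaSeq s n / (Real.GammaSeq a n * Real.GammaSeq b n) := by
  have hprod : ∀ N, gaussCoeff a b c N / gaussCoeff s 1 1 N =
      (∏ j ∈ Finset.range N, (a + j)) * (∏ j ∈ Finset.range N, (b + j)) /
      ((∏ j ∈ Finset.range N, (c + j)) * (∏ j ∈ Finset.range N, (s + j))) := by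
    intro N
    induction N with
    | zero => simp [gaussCoeff]
    | succ N ih =>
      simp only [Finset.prod_range_succ, gaussCoeff_succ]
      rw [mul_div_mul_comm, ih]
      have : c + N ≠ 0 := by positivity
      have : s + N ≠ 0 := by positivity
      field_simp
  have hP (t : ℝ) (ht : ∀ k : ℕ, t + k ≠ 0) : ∏ j ∈ Finset.range (n + 1), (t + j) ≠ 0 :=
    Finset.prod_ne_zero_iff.2 fun k _ => ht k
  have hPa := hP a ha
  have hPb := hP b hb
  have hPc := hP c (fun k => by positivity)
  have hPs := hP s (fun k => by positivity)
  have hn0 : (0 : ℝ) < n := by positivity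
  have hpow : (n : ℝ) ^ c * (n : ℝ) ^ s = (n : ℝ) ^ a * (n : ℝ) ^ b := by
    rw [← Real.rpow_add hn0, ← Real.rpow_add hn0, hs]; ring_nf
  have hfact : ((n.factorial : ℕ) : ℝ) ≠ 0 := by positivity
  have h1 : (n : ℝ) ^ a ≠ 0 := (Real.rpow_pos_of_pos hn0 _).ne'
  have h2 : (n : ℝ) ^ b ≠ 0 := (Real.rpow_pos_of_pos hn0 _).ne'
  rw [hprod]
  simp only [Real.GammaSeq]
  rw [div_mul_div_comm, div_mul_div_comm, div_div_div_eq, div_eq_div_iff (by positivity)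
    (by positivity)]
  linear_combination (-(∏ j ∈ Finset.range (n + 1), (a + j)) *
    (∏ j ∈ Finset.range (n + 1), (b + j)) * (∏ j ∈ Finset.range (n + 1), (c + j)) *
    (∏ j ∈ Finset.range (n + 1), (s + j)) * (n.factorial : ℝ) ^ 2) * hpow

/-- The leading behaviour of the Gauss hypergeometric function at `1` when `c < a + b`. -/
theorem tendsto_one_sub_rpow_mul_hypergeometric {a b c s : ℝ} (hc : 0 < c)
    (hs : s = a + b - c) (hs0 : 0 < s) (ha : ∀ k : ℕ, a + k ≠ 0) (hb : ∀ k : ℕ, b + k ≠ 0) :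
    Tendsto (fun x : ℝ => (1 - x) ^ s * ₂F₁ a b c x) (𝓝[<] 1)
      (𝓝 (Real.Gamma c * Real.Gamma s / (Real.Gamma a * Real.Gamma b))) := by
  have hIoo : ∀ x ∈ Ioo (0 : ℝ) 1, |x| < 1 := fun x hx => by rw [abs_of_pos hx.1]; exact hx.2
  have hL : Tendsto (fun k => gaussCoeff a b c k / gaussCoeff s 1 1 k) atTop
      (𝓝 (Real.Gamma c * Real.Gamma s / (Real.Gamma a * Real.Gamma b))) := by
    rw [← tendsto_add_atTop_iff_nat 1]
    have hG (t : ℝ) (ht : ∀ k : ℕ, t + k ≠ 0) : Real.Gamma t ≠ 0 :=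
      Real.Gamma_ne_zero fun m h => ht m (by rw [h]; ring)
    refine Tendsto.congr' ?_ (((Real.GammaSeq_tendsto_Gamma c).mul
      (Real.GammaSeq_tendsto_Gamma s)).div ((Real.GammaSeq_tendsto_Gamma a).mul
      (Real.GammaSeq_tendsto_Gamma b)) (mul_ne_zero (hG a ha) (hG b hb)))
    filter_upwards [eventually_ne_atTop 0] with n hn
    exact (gaussCoeff_succ_div a b n hn hc hs hs0 ha hb).symm
  have hE : ∀ x ∈ Ioo (0 : ℝ) 1, ∑' k, gaussCoeff s 1 1 k * x ^ k = (1 - x) ^ (-s) :=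
    fun x hx => (hasSum_binomial s (hIoo x hx)).tsum_eq
  have hnear : ∀ᶠ x in 𝓝[<] (1 : ℝ), x ∈ Ioo (0 : ℝ) 1 := Ioo_mem_nhdsLT (zero_lt_one' ℝ)
  have h := tendsto_tsum_div_tsum (gaussCoeff_pos hs0)
    (fun x hx => (hasSum_gaussCoeff a b hc (hIoo x hx)).summable)
    (fun x hx => (hasSum_binomial s (hIoo x hx)).summable) hL (by
      have h0 : Tendsto (fun x : ℝ => 1 - x) (𝓝[<] 1) (𝓝[>] 0) := by
        refine tendsto_nhdsWithin_iff.2 ⟨?_, eventually_mem_nhdsWithin.mono fun x hx => ?_⟩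
        · have : Tendsto (fun x : ℝ => 1 - x) (𝓝 1) (𝓝 (1 - 1)) :=
            tendsto_const_nhds.sub tendsto_id
          simpa using this.mono_left nhdsWithin_le_nhds
        · simpa using hx
      refine Tendsto.congr' ?_ ((tendsto_rpow_neg_nhdsGT_zero (by linarith : -s < 0)).comp h0)
      filter_upwards [hnear] with x hx
      rw [hE x hx, Function.comp_apply])
  refine h.congr' ?_
  filter_upwards [hnear] with x hx
  have hx1 : 0 < 1 - x := by linarith [hx.2]
  rw [hE x hx, ← hypergeometric_eq_tsum, Real.rpow_neg hx1.le, div_inv_eq_mul, mul_comm]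

/-! ### Admissible parameters and the two expressions for Φ_n beyond 1. -/

/-- The parameter values for which `Φ_n` is a well defined, square integrable eigenfunction of the
Jacobi operator on each of the two intervals. -/
structure Admissible (α β n : ℝ) : Prop where
  ne_int : ∀ k : ℤ, n ≠ k
  add_ne_int : ∀ k : ℤ, n + α ≠ k
  beta : -1 < β
  pos₁ : 0 < n + β + 1
  pos₂ : 0 < n + α + β + 1
  pos₃ : 0 < 2 * n + α + β + 1

/-- The normalizing constant of `Φ_n` on `(1,∞)`. -/
noncomputable def rightConst (α β n : ℝ) : ℝ :=
  Real.Gamma (β + 1) * Real.Gamma (n + 1) /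
    (Real.Gamma (-n - α) * Real.Gamma (2 * n + α + β + 2))

/-- Write n = θ + k. For k ≥ 0 the positivity claims are direct. For k ≤ −1 both n and n+α are
negative, and subtracting either from 2n+α+β+1 > 0 leaves a positive number. -/
theorem admissible_of_mem_indexSet {α β θ n : ℝ} (hβ : -1 < β)
    (hθ₀ : 0 < θ) (hθ₁ : θ < 1) (hθα₀ : 0 < θ + α) (hθα₁ : θ + α < 1)
    (hn : n ∈ indexSet α β θ) : Admissible α β n := by
  obtain ⟨⟨k, hk⟩, hpos⟩ := hn
  have hnk : n = θ + k := by linarith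
  have hint (t : ℝ) (h0 : 0 < t) (h1 : t < 1) (j : ℤ) : t + k ≠ j := by
    intro h
    have h2 : (0 : ℝ) < ((j - k : ℤ) : ℝ) := by push_cast; linarith
    have h3 : ((j - k : ℤ) : ℝ) < ((1 : ℤ) : ℝ) := by push_cast; linarith
    have h2' : 0 < j - k := by exact_mod_cast h2
    have h3' : j - k < 1 := by exact_mod_cast h3
    omega
  refine ⟨fun j => by rw [hnk]; exact hint θ hθ₀ hθ₁ j, fun j => ?_, hβ, ?_, ?_, hpos⟩
  · rw [hnk, show θ + k + α = θ + α + k by ring]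
    exact hint (θ + α) hθα₀ hθα₁ j
  all_goals
    rcases le_or_gt 0 k with hk0 | hk0
    · have : (0 : ℝ) ≤ k := by exact_mod_cast hk0
      linarith
    · have : (k : ℝ) ≤ -1 := by exact_mod_cast (by omega : k ≤ -1)
      linarith

variable {α β θ n x : ℝ}

theorem Phi_of_lt (hx : x < 1) : Phi α β n x = ₂F₁ (-n) (n + α + β + 1) (β + 1) x := by
  rw [Phi, if_pos hx]

theorem Phi_of_gt (hx : 1 < x) : Phi α β n x = rightConst α β n * (x ^ (-n - β - 1) *
    (x - 1) ^ (-α) * ₂F₁ (n + 1) (n + β + 1) (2 * n + α + β + 2) (1 / x)) := by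
  rw [Phi, if_neg hx.not_gt, rightConst]
  ring

theorem sub_one_rpow (hx : 1 < x) (r : ℝ) : (x - 1) ^ r = x ^ r * (1 - 1 / x) ^ r := by
  have hx0 : 0 < x := by linarith
  have h1 : 1 / x < 1 := by rw [div_lt_one hx0]; exact hx
  rw [← Real.mul_rpow hx0.le (by linarith)]
  congr 1
  field_simp

theorem one_div_mem (hx : 1 < x) : 0 < 1 / x ∧ 1 / x < 1 := by
  have hx0 : 0 < x := by linarith
  exact ⟨by positivity, by rw [div_lt_one hx0]; exact hx⟩

/-- Euler's transformation absorbs the factor (x−1)^(−α); the decay at infinity becomes visible and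
the function is ready for `hasDerivAt_rpow_mul_hypergeometric_inv`. -/
theorem Phi_of_gt' (hn : 0 < 2 * n + α + β + 2) (hx : 1 < x) :
    Phi α β n x = rightConst α β n * (x ^ (-(n + α + β + 1)) *
      ₂F₁ (n + α + β + 1) (n + α + 1) (2 * n + α + β + 2) (1 / x)) := by
  have hx0 : 0 < x := by linarith
  obtain ⟨h0, h1⟩ := one_div_mem hx
  rw [Phi_of_gt hx, hypergeometric_euler _ _ hn h0.le h1, sub_one_rpow hx,
    show 2 * n + α + β + 2 - (n + 1) - (n + β + 1) = α by ring,
    show 2 * n + α + β + 2 - (n + 1) = n + α + β + 1 by ring,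
    show 2 * n + α + β + 2 - (n + β + 1) = n + α + 1 by ring,
    show -(n + α + β + 1) = -n - β - 1 + -α by ring, Real.rpow_add hx0]
  have : (1 - 1 / x) ^ (-α) * (1 - 1 / x) ^ α = 1 := by
    rw [← Real.rpow_add (by linarith)]; simp
  linear_combination (rightConst α β n * x ^ (-n - β - 1) * x ^ (-α) *
    ₂F₁ (n + α + β + 1) (n + α + 1) (2 * n + α + β + 2) (1 / x)) * this

theorem Admissible.Gamma_ne_zero (h : Admissible α β n) :
    Real.Gamma (β + 1) ≠ 0 ∧ Real.Gamma (n + 1) ≠ 0 ∧ Real.Gamma (-n - α) ≠ 0 ∧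
      Real.Gamma (2 * n + α + β + 2) ≠ 0 ∧ Real.Gamma (n + β + 1) ≠ 0 ∧
      Real.Gamma (n + α + β + 1) ≠ 0 ∧ Real.Gamma (n + α + 1) ≠ 0 ∧ Real.Gamma (-n) ≠ 0 := by
  have hβ := h.beta
  have h1 := h.pos₁
  have h2 := h.pos₂
  have h3 := h.pos₃
  refine ⟨(Real.Gamma_pos_of_pos (by linarith)).ne', Real.Gamma_ne_zero fun m hm => ?_,
    Real.Gamma_ne_zero fun m hm => ?_, (Real.Gamma_pos_of_pos (by linarith)).ne',
    (Real.Gamma_pos_of_pos (by linarith)).ne', (Real.Gamma_pos_of_pos (by linarith)).ne',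
    Real.Gamma_ne_zero fun m hm => ?_, Real.Gamma_ne_zero fun m hm => ?_⟩
  · exact h.ne_int (-m - 1) (by push_cast; linarith)
  · exact h.add_ne_int m (by push_cast; linarith)
  · exact h.add_ne_int (-m - 1) (by push_cast; linarith)
  · exact h.ne_int m (by push_cast; linarith)

theorem continuousAt_Gamma_of_ne_zero {s : ℝ} (hs : Real.Gamma s ≠ 0) :
    ContinuousAt Real.Gamma s := by
  refine (Real.differentiableAt_Gamma fun m hm => hs ?_).continuousAt
  rw [hm, Real.Gamma_neg_nat_eq_zero]

theorem Admissible.continuousAt_rightConst (h : Admissible α β n) :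
    ContinuousAt (fun q : ℝ × ℝ => rightConst q.1 β q.2) (α, n) := by
  obtain ⟨h1, h2, h3, h4, -⟩ := h.Gamma_ne_zero
  have aux {g : ℝ × ℝ → ℝ} (hg : Continuous g) (h0 : Real.Gamma (g (α, n)) ≠ 0) :
      ContinuousAt (fun q => Real.Gamma (g q)) (α, n) :=
    ContinuousAt.comp (f := g) (continuousAt_Gamma_of_ne_zero h0) hg.continuousAt
  unfold rightConst
  exact (continuousAt_const.mul (aux (by fun_prop) h2)).div
    ((aux (by fun_prop) h3).mul (aux (by fun_prop) h4)) (mul_ne_zero h3 h4)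

theorem continuousOn_Phi_left (hβ : -1 < β) : ContinuousOn (Phi α β n) (Ioo 0 1) := by
  refine ContinuousOn.congr (f := fun x : ℝ => ₂F₁ (-n) (n + α + β + 1) (β + 1) x) ?_
    fun x hx => Phi_of_lt hx.2
  exact fun x hx => (continuousAt_hypergeometric _ _ (by linarith)
    (by rw [abs_of_pos hx.1]; exact hx.2)).continuousWithinAt

theorem continuousOn_Phi_right (hn : 0 < 2 * n + α + β + 2) :
    ContinuousOn (Phi α β n) (Ioi 1) := by
  refine ContinuousOn.congr (fun x hx => ContinuousAt.continuousWithinAt ?_)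
    fun x hx => Phi_of_gt' hn hx
  exact continuousAt_const.mul
    (hasDerivAt_rpow_mul_hypergeometric_inv _ _ hn hx).continuousAt

theorem Ioi_zero_ae_eq : (Ioi (0 : ℝ)) =ᵐ[volume] (Ioo 0 1 ∪ Ioi 1 : Set ℝ) := by
  rw [← Ioo_union_Ici_eq_Ioi (zero_lt_one' ℝ)]
  exact (ae_eq_refl _).union Ioi_ae_eq_Ici.symm

theorem aestronglyMeasurable_Phi (hβ : -1 < β) (hn : 0 < 2 * n + α + β + 2) :
    AEStronglyMeasurable (Phi α β n) (volume.restrict (Ioi 0)) := by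
  rw [Measure.restrict_congr_set Ioi_zero_ae_eq, aestronglyMeasurable_union_iff]
  exact ⟨(continuousOn_Phi_left hβ).aestronglyMeasurable measurableSet_Ioo,
    (continuousOn_Phi_right hn).aestronglyMeasurable measurableSet_Ioi⟩

theorem measurable_weight : Measurable (weight α β θ) := by
  unfold weight
  refine Measurable.ite measurableSet_Iio ?_ ?_ <;> fun_prop

/-! ### Integrable majorants and continuity of the inner products in the parameters. -/

/-- A bound for `Φ_n` on `(0,1)`, locally uniform in the parameters. -/
theorem exists_Phi_le_left {α₀ s : ℝ} (n₀ : ℝ) (hβ : -1 < β) (hs : 0 < s) (h : α₀ < s) :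
    ∃ C, 0 < C ∧ ∀ᶠ q : ℝ × ℝ in 𝓝 (α₀, n₀), ∀ x ∈ Ioo (0 : ℝ) 1,
      |Phi q.1 β q.2 x| ≤ C * (1 - x) ^ (-s) := by
  obtain ⟨C, hC, H⟩ := exists_hypergeometric_le (a₀ := -n₀) (b₀ := n₀ + α₀ + β + 1)
    (c₀ := β + 1) (by linarith) hs (by linarith)
  refine ⟨C, hC, ?_⟩
  have hcont : ContinuousAt (fun q : ℝ × ℝ => (-q.2, q.2 + q.1 + β + 1, β + 1)) (α₀, n₀) := by
    fun_prop
  filter_upwards [hcont.eventually H] with q hq x hx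
  rw [Phi_of_lt hx.2]
  exact hq x hx.1.le hx.2

/-- A bound for `Φ_n` on `(1,∞)`, locally uniform in the parameters. -/
theorem exists_Phi_le_right {α₀ n₀ s δ : ℝ} (hn : Admissible α₀ β n₀) (hs : 0 < s) (h : α₀ < s)
    (hδ : 0 < δ) :
    ∃ C, 0 < C ∧ ∀ᶠ q : ℝ × ℝ in 𝓝 (α₀, n₀), ∀ x, 1 < x →
      |Phi q.1 β q.2 x| ≤ C * (x ^ (-(n₀ + α₀ + β + 1) + δ) * (1 - 1 / x) ^ (-s)) := by
  have h3 := hn.pos₃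
  obtain ⟨C, hC, H⟩ := exists_hypergeometric_le (a₀ := n₀ + α₀ + β + 1) (b₀ := n₀ + α₀ + 1)
    (c₀ := 2 * n₀ + α₀ + β + 2) (by linarith) hs (by linarith)
  refine ⟨(|rightConst α₀ β n₀| + 1) * C, by positivity, ?_⟩
  have hcont : ContinuousAt (fun q : ℝ × ℝ =>
    (q.2 + q.1 + β + 1, q.2 + q.1 + 1, 2 * q.2 + q.1 + β + 2)) (α₀, n₀) := by
    fun_prop
  have e1 : ∀ᶠ q : ℝ × ℝ in 𝓝 (α₀, n₀), |rightConst q.1 β q.2| < |rightConst α₀ β n₀| + 1 :=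
    hn.continuousAt_rightConst.abs.tendsto.eventually_lt_const (by simp)
  have e2 : ∀ᶠ q : ℝ × ℝ in 𝓝 (α₀, n₀), -(q.2 + q.1 + β + 1) < -(n₀ + α₀ + β + 1) + δ :=
    (ContinuousAt.tendsto (f := fun q : ℝ × ℝ => -(q.2 + q.1 + β + 1))
      (by fun_prop)).eventually_lt_const (by simpa using hδ)
  have e3 : ∀ᶠ q : ℝ × ℝ in 𝓝 (α₀, n₀), 0 < 2 * q.2 + q.1 + β + 2 :=
    (ContinuousAt.tendsto (f := fun q : ℝ × ℝ => 2 * q.2 + q.1 + β + 2)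
      (by fun_prop)).eventually_const_lt (by simp only; linarith)
  filter_upwards [hcont.eventually H, e1, e2, e3] with q hq h1 h2 h3 x hx
  obtain ⟨hu0, hu1⟩ := one_div_mem hx
  have hx0 : 0 < x := by linarith
  rw [Phi_of_gt' h3 hx, abs_mul, abs_mul, abs_of_pos (Real.rpow_pos_of_pos hx0 _), mul_assoc]
  refine mul_le_mul h1.le ?_ (by positivity) (by positivity)
  calc _ ≤ x ^ (-(n₀ + α₀ + β + 1) + δ) * (C * (1 - 1 / x) ^ (-s)) :=
        mul_le_mul (Real.rpow_le_rpow_of_exponent_le hx.le h2.le) (hq _ hu0.le hu1) (abs_nonneg _)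
          (by positivity)
    _ = _ := by ring

theorem integrableOn_rpow_mul_one_sub_rpow {a b : ℝ} (ha : -1 < a) (hb : -1 < b) :
    IntegrableOn (fun x : ℝ => x ^ a * (1 - x) ^ b) (Ioo 0 1) := by
  have h := Complex.betaIntegral_convergent (u := (a + 1 : ℝ)) (v := (b + 1 : ℝ))
    (by simp; linarith) (by simp; linarith)
  rw [intervalIntegrable_iff_integrableOn_Ioo_of_le zero_le_one] at h
  refine h.re.congr ?_
  refine (ae_restrict_iff' measurableSet_Ioo).2 (ae_of_all _ fun x hx => ?_)
  have h1 : (0 : ℝ) ≤ 1 - x := by linarith [hx.2]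
  beta_reduce
  rw [show ((a + 1 : ℝ) : ℂ) - 1 = (a : ℂ) by push_cast; ring,
    show ((b + 1 : ℝ) : ℂ) - 1 = (b : ℂ) by push_cast; ring,
    show (1 : ℂ) - x = ((1 - x : ℝ) : ℂ) by push_cast; ring,
    ← Complex.ofReal_cpow hx.1.le, ← Complex.ofReal_cpow h1, ← Complex.ofReal_mul]
  simp

/-- The substitution u = 1/x leads to a beta integral with exponents −p−2 and b. -/
theorem integrableOn_rpow_mul_one_sub_inv_rpow {p b : ℝ} (hp : p < -1) (hb : -1 < b) :
    IntegrableOn (fun x : ℝ => x ^ p * (1 - 1 / x) ^ b) (Ioi 1) := by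
  have himg : (fun x : ℝ => 1 / x) '' Ioi 1 = Ioo 0 1 := by
    ext u
    constructor
    · rintro ⟨x, hx, rfl⟩
      exact one_div_mem hx
    · intro hu
      exact ⟨1 / u, by rw [mem_Ioi, lt_div_iff₀ hu.1]; linarith [hu.2], by simp⟩
  have h := integrableOn_rpow_mul_one_sub_rpow (a := -p - 2) (by linarith) hb
  rw [← himg, integrableOn_image_iff_integrableOn_abs_deriv_smul measurableSet_Ioi
    (f' := fun x => -(x ^ 2)⁻¹) (fun x hx => by
      have hx0 : x ≠ 0 := by have : (1 : ℝ) < x := hx; positivity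
      simpa [one_div] using (hasDerivAt_inv hx0).hasDerivWithinAt)
    (fun x _ y _ hxy => by simpa using hxy)] at h
  refine h.congr_fun (fun x hx => ?_) measurableSet_Ioi
  have hx0 : 0 < x := by have : (1 : ℝ) < x := hx; positivity
  have e : |(-(x ^ 2)⁻¹)| * (1 / x) ^ (-p - 2) = x ^ p := by
    rw [abs_neg, abs_of_pos (by positivity), one_div, Real.inv_rpow hx0.le, ← Real.rpow_neg hx0.le,
      ← Real.rpow_natCast, ← Real.rpow_neg hx0.le, ← Real.rpow_add hx0]
    congr 1
    push_cast
    ring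
  simp only [smul_eq_mul]
  rw [← mul_assoc, e]

/-- An integrable majorant for `Φ_m Φ_n w`, locally uniform in the parameters. -/
theorem exists_integrable_majorant {α₀ m₀ n₀ : ℝ} (hα : |α₀| < 1) (hm : Admissible α₀ β m₀)
    (hn : Admissible α₀ β n₀) (hθ : Real.sin (Real.pi * (α₀ + θ)) ≠ 0) :
    ∃ G : ℝ → ℝ, IntegrableOn G (Ioi 0) ∧ ∀ᶠ q : ℝ × ℝ × ℝ in 𝓝 (α₀, m₀, n₀),
      ∀ᵐ x ∂volume.restrict (Ioi 0),
        ‖Phi q.1 β q.2.1 x * Phi q.1 β q.2.2 x * weight q.1 β θ x‖ ≤ G x := by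
  have hm3 := hm.pos₃
  have hn3 := hn.pos₃
  have hβ := hn.beta
  obtain ⟨δ, hδ0, hδα, hδn⟩ : ∃ δ : ℝ, 0 < δ ∧ |α₀| + 4 * δ ≤ 1 ∧
      4 * δ ≤ m₀ + n₀ + α₀ + β + 1 :=
    ⟨min ((1 - |α₀|) / 4) ((m₀ + n₀ + α₀ + β + 1) / 4), lt_min (by linarith) (by linarith),
      by linarith [min_le_left ((1 - |α₀|) / 4) ((m₀ + n₀ + α₀ + β + 1) / 4)],
      by linarith [min_le_right ((1 - |α₀|) / 4) ((m₀ + n₀ + α₀ + β + 1) / 4)]⟩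
  -- Here s = max(α₀, 0) + δ, so that α₀ − δ − 2s = −|α₀| − 3δ > −1. This is where |α₀| < 1 gives
  -- integrability at 1; the other condition on δ secures it at infinity.
  obtain ⟨s, hs⟩ : ∃ s : ℝ, s = (α₀ + |α₀|) / 2 + δ := ⟨_, rfl⟩
  have hs0 : 0 < s := by linarith [neg_abs_le α₀]
  have hs1 : α₀ < s := by linarith [le_abs_self α₀]
  obtain ⟨C₁, hC₁, H₁⟩ := exists_Phi_le_left (β := β) m₀ hβ hs0 hs1
  obtain ⟨C₂, hC₂, H₂⟩ := exists_Phi_le_left (β := β) n₀ hβ hs0 hs1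
  obtain ⟨D₁, hD₁, K₁⟩ := exists_Phi_le_right hm hs0 hs1 hδ0
  obtain ⟨D₂, hD₂, K₂⟩ := exists_Phi_le_right hn hs0 hs1 hδ0
  set κ : ℝ → ℝ := fun a => Real.sin (Real.pi * θ) / Real.sin (Real.pi * (a + θ)) with hκ
  have hκc : ContinuousAt κ α₀ :=
    continuousAt_const.div (by fun_prop) hθ
  refine ⟨fun x => if x < 1 then C₁ * C₂ * (x ^ β * (1 - x) ^ (α₀ - δ - 2 * s)) else
    D₁ * D₂ * (|κ α₀| + 1) * (x ^ (-(m₀ + n₀ + α₀ + β + 2) + 3 * δ) *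
      (1 - 1 / x) ^ (α₀ - δ - 2 * s)), ?_, ?_⟩
  · rw [integrableOn_congr_set_ae Ioi_zero_ae_eq, integrableOn_union]
    refine ⟨IntegrableOn.congr_fun ((integrableOn_rpow_mul_one_sub_rpow hβ (?_ :
      -1 < α₀ - δ - 2 * s)).const_mul (C₁ * C₂)) (fun x hx => by simp [hx.2]) measurableSet_Ioo,
      IntegrableOn.congr_fun ((integrableOn_rpow_mul_one_sub_inv_rpow (?_ :
        -(m₀ + n₀ + α₀ + β + 2) + 3 * δ < -1) (?_ : -1 < α₀ - δ - 2 * s)).const_mul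
        (D₁ * D₂ * (|κ α₀| + 1))) (fun x hx => by simp [(show 1 < x from hx).not_gt])
        measurableSet_Ioi⟩ <;> linarith
  · have t1 : Tendsto (fun q : ℝ × ℝ × ℝ => (q.1, q.2.1)) (𝓝 (α₀, m₀, n₀)) (𝓝 (α₀, m₀)) :=
      ContinuousAt.tendsto (by fun_prop)
    have t2 : Tendsto (fun q : ℝ × ℝ × ℝ => (q.1, q.2.2)) (𝓝 (α₀, m₀, n₀)) (𝓝 (α₀, n₀)) :=
      ContinuousAt.tendsto (by fun_prop)
    have t3 : Tendsto (fun q : ℝ × ℝ × ℝ => q.1) (𝓝 (α₀, m₀, n₀)) (𝓝 α₀) :=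
      ContinuousAt.tendsto (f := fun q : ℝ × ℝ × ℝ => q.1) (by fun_prop)
    filter_upwards [t1.eventually H₁, t2.eventually H₂, t1.eventually K₁, t2.eventually K₂,
      t3.eventually_lt_const (by linarith : α₀ < α₀ + δ),
      t3.eventually_const_lt (by linarith : α₀ - δ < α₀),
      ((hκc.abs.tendsto).comp t3).eventually_lt_const (by simp : |κ α₀| < |κ α₀| + 1)]
      with q h1 h2 k1 k2 ha1 ha2 hk
    have hne : ∀ᵐ x : ℝ, x ≠ 1 := by simp [ae_iff]
    rw [ae_restrict_iff' measurableSet_Ioi]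
    filter_upwards [hne] with x hx1 hx0
    have hx0 : 0 < x := hx0
    rw [Real.norm_eq_abs, abs_mul, abs_mul]
    rcases lt_or_gt_of_ne hx1 with hx | hx
    · have hx1 : 0 < 1 - x := by linarith
      rw [if_pos hx, weight, if_pos hx, abs_of_pos (by positivity : 0 < x ^ β * (1 - x) ^ q.1)]
      calc _ ≤ C₁ * (1 - x) ^ (-s) * (C₂ * (1 - x) ^ (-s)) * (x ^ β * (1 - x) ^ (α₀ - δ)) := by
            gcongr ?_ * ?_ * (_ * ?_)
            · exact h1 x ⟨hx0, hx⟩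
            · exact h2 x ⟨hx0, hx⟩
            · exact Real.rpow_le_rpow_of_exponent_ge hx1 (by linarith) ha2.le
        _ = _ := by
            rw [show α₀ - δ - 2 * s = -s + -s + (α₀ - δ) by ring, Real.rpow_add hx1,
              Real.rpow_add hx1]
            ring
    · obtain ⟨hu0, hu1⟩ := one_div_mem hx
      have hu2 : 0 < 1 - 1 / x := by linarith
      have hxx : 0 < x - 1 := by linarith
      rw [if_neg hx.not_gt, weight, if_neg hx.not_gt, abs_mul,
        abs_of_pos (by positivity : 0 < x ^ β * (x - 1) ^ q.1), sub_one_rpow hx]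
      calc _ ≤ D₁ * (x ^ (-(m₀ + α₀ + β + 1) + δ) * (1 - 1 / x) ^ (-s)) *
            (D₂ * (x ^ (-(n₀ + α₀ + β + 1) + δ) * (1 - 1 / x) ^ (-s))) *
            ((|κ α₀| + 1) * (x ^ β * (x ^ (α₀ + δ) * (1 - 1 / x) ^ (α₀ - δ)))) := by
            gcongr ?_ * ?_ * (?_ * (_ * (?_ * ?_)))
            · exact k1 x hx
            · exact k2 x hx
            · exact hk.le
            · exact Real.rpow_le_rpow_of_exponent_le hx.le ha1.le
            · exact Real.rpow_le_rpow_of_exponent_ge hu2 (by linarith) ha2.le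
        _ = _ := by
            have e : x ^ (-(m₀ + n₀ + α₀ + β + 2) + 3 * δ) = x ^ (-(m₀ + α₀ + β + 1) + δ) *
                x ^ (-(n₀ + α₀ + β + 1) + δ) * x ^ β * x ^ (α₀ + δ) := by
              rw [← Real.rpow_add hx0, ← Real.rpow_add hx0, ← Real.rpow_add hx0]
              ring_nf
            rw [show α₀ - δ - 2 * s = -s + -s + (α₀ - δ) by ring, Real.rpow_add hu2,
              Real.rpow_add hu2, e]
            ring

theorem integrableOn_Phi_mul_Phi {m : ℝ} (hα : |α| < 1) (hm : Admissible α β m)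
    (hn : Admissible α β n) (hθ : Real.sin (Real.pi * (α + θ)) ≠ 0) :
    IntegrableOn (fun x => Phi α β m x * Phi α β n x * weight α β θ x) (Ioi 0) := by
  obtain ⟨G, hG, H⟩ := exists_integrable_majorant (θ := θ) hα hm hn hθ
  have h1 := hm.pos₃
  have h2 := hn.pos₃
  exact Integrable.mono' hG (((aestronglyMeasurable_Phi hm.beta (by linarith)).mul
    (aestronglyMeasurable_Phi hn.beta (by linarith))).mul
    measurable_weight.aestronglyMeasurable) H.self_of_nhds

theorem tendsto_hypergeometric_params {ι : Type*} {l : Filter ι} {A B C : ι → ℝ} {a b c : ℝ}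
    (hc : 0 < c) (hx : |x| < 1) (hA : Tendsto A l (𝓝 a)) (hB : Tendsto B l (𝓝 b))
    (hC : Tendsto C l (𝓝 c)) :
    Tendsto (fun i => ₂F₁ (A i) (B i) (C i) x) l (𝓝 (₂F₁ a b c x)) := by
  have h := (continuousAt_hypergeometric_params a b hc hx).tendsto
  have h' := h.comp (hA.prodMk_nhds (hB.prodMk_nhds hC))
  simpa only [Function.comp_def] using h'

theorem tendsto_Phi {ι : Type*} {l : Filter ι} {a r : ι → ℝ} (hn : Admissible α β n)
    (hx0 : 0 < x) (hx1 : x ≠ 1) (ha : Tendsto a l (𝓝 α)) (hr : Tendsto r l (𝓝 n)) :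
    Tendsto (fun i => Phi (a i) β (r i) x) l (𝓝 (Phi α β n x)) := by
  have hβ := hn.beta
  have h3 := hn.pos₃
  have hq : Tendsto (fun i => (a i, r i)) l (𝓝 (α, n)) := ha.prodMk_nhds hr
  rcases lt_or_gt_of_ne hx1 with hx | hx
  · have hx' : |x| < 1 := by rwa [abs_of_pos hx0]
    simp only [Phi_of_lt hx]
    exact tendsto_hypergeometric_params (by linarith) hx' hr.neg
      (((hr.add ha).add_const β).add_const 1) tendsto_const_nhds
  · obtain ⟨hu0, hu1⟩ := one_div_mem hx
    have hx' : |1 / x| < 1 := by rwa [abs_of_pos hu0]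
    simp only [Phi_of_gt hx]
    have t2 := tendsto_hypergeometric_params (by linarith : 0 < 2 * n + α + β + 2) hx'
      (hr.add_const 1) ((hr.add_const β).add_const 1)
      ((((hr.const_mul 2).add ha).add_const β).add_const 2)
    have t1 : Tendsto (fun i => rightConst (a i) β (r i)) l (𝓝 (rightConst α β n)) :=
      hn.continuousAt_rightConst.tendsto.comp hq
    have t3 : Tendsto (fun i => x ^ (-r i - β - 1)) l (𝓝 (x ^ (-n - β - 1))) :=
      tendsto_const_nhds.rpow ((hr.neg.sub_const β).sub_const 1) (Or.inl hx0.ne')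
    have t4 : Tendsto (fun i => (x - 1) ^ (-a i)) l (𝓝 ((x - 1) ^ (-α))) :=
      tendsto_const_nhds.rpow ha.neg (Or.inl (by linarith))
    exact t1.mul ((t3.mul t4).mul t2)

theorem tendsto_weight {ι : Type*} {l : Filter ι} {a : ι → ℝ} (hx1 : x ≠ 1)
    (hθ : Real.sin (Real.pi * (α + θ)) ≠ 0) (ha : Tendsto a l (𝓝 α)) :
    Tendsto (fun i => weight (a i) β θ x) l (𝓝 (weight α β θ x)) := by
  rcases lt_or_gt_of_ne hx1 with hx | hx
  · simp only [weight, if_pos hx]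
    exact (tendsto_const_nhds.rpow ha (Or.inl (by linarith))).const_mul _
  · simp only [weight, if_neg hx.not_gt]
    have t1 : Tendsto (fun i => Real.sin (Real.pi * (a i + θ))) l
        (𝓝 (Real.sin (Real.pi * (α + θ)))) :=
      (Real.continuous_sin.tendsto _).comp ((ha.add_const θ).const_mul _)
    exact (tendsto_const_nhds.div t1 hθ).mul
      ((tendsto_const_nhds.rpow ha (Or.inl (by linarith))).const_mul _)

/-- The inner products `∫ Φ_m Φ_n w` depend continuously on the parameters. -/
theorem tendsto_integral_Phi_mul_Phi {ι : Type*} {l : Filter ι} [l.IsCountablyGenerated]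
    {a p q : ι → ℝ} {m : ℝ} (hα : |α| < 1) (hm : Admissible α β m)
    (hn : Admissible α β n) (hθ : Real.sin (Real.pi * (α + θ)) ≠ 0)
    (ha : Tendsto a l (𝓝 α)) (hp : Tendsto p l (𝓝 m)) (hq : Tendsto q l (𝓝 n)) :
    Tendsto (fun i => ∫ x in Ioi (0 : ℝ), Phi (a i) β (p i) x * Phi (a i) β (q i) x *
      weight (a i) β θ x) l
      (𝓝 (∫ x in Ioi (0 : ℝ), Phi α β m x * Phi α β n x * weight α β θ x)) := by
  obtain ⟨G, hG, H⟩ := exists_integrable_majorant (θ := θ) hα hm hn hθ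
  have h1 := hm.pos₃
  have h2 := hn.pos₃
  have hβ := hn.beta
  have e1 : ∀ᶠ i in l, 0 < 2 * p i + a i + β + 2 :=
    (((hp.const_mul 2).add ha).add_const β |>.add_const 2).eventually_const_lt (by linarith)
  have e2 : ∀ᶠ i in l, 0 < 2 * q i + a i + β + 2 :=
    (((hq.const_mul 2).add ha).add_const β |>.add_const 2).eventually_const_lt (by linarith)
  refine tendsto_integral_filter_of_dominated_convergence G ?_
    ((ha.prodMk_nhds (hp.prodMk_nhds hq)).eventually H) hG ?_
  · filter_upwards [e1, e2] with i hi1 hi2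
    exact ((aestronglyMeasurable_Phi hβ hi1).mul (aestronglyMeasurable_Phi hβ hi2)).mul
      measurable_weight.aestronglyMeasurable
  · have hne : ∀ᵐ x : ℝ, x ≠ 1 := by simp [ae_iff]
    rw [ae_restrict_iff' measurableSet_Ioi]
    filter_upwards [hne] with x hx1 hx0
    have hx0 : 0 < x := hx0
    exact ((tendsto_Phi hm hx0 hx1 ha hp).mul (tendsto_Phi hn hx0 hx1 ha hq)).mul
      (tendsto_weight hx1 hθ ha)

/-! ### The Sturm–Liouville equation and the boundary values at 0, 1 and ∞. -/

section

variable {α β θ n x : ℝ}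

/-- The quasi-derivative `x^{β+1} (1-x)^{α+1} Φ_n'` of `Φ_n` on `(0,1)`. -/
noncomputable def quasiDerivLeft (α β n x : ℝ) : ℝ :=
  -n * (n + α + β + 1) / (β + 1) *
    (x ^ (β + 1) * ₂F₁ (n + β + 1) (-n - α) (β + 1 + 1) x)

/-- The quasi-derivative `-x^{β+1} (x-1)^{α+1} Φ_n'` of `Φ_n` on `(1,∞)`. -/
noncomputable def quasiDerivRight (α β n x : ℝ) : ℝ :=
  rightConst α β n * (n + α + β + 1) *
    (x ^ (-n) * ₂F₁ n (n + β + 1) (2 * n + α + β + 2) (1 / x))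

/-- The eigenvalue of the Jacobi operator at `Φ_n`. -/
noncomputable def eigenvalue (α β n : ℝ) : ℝ := n * (n + α + β + 1)

theorem hypergeometric_euler_succ (hβ : -1 < β) (hx : x ∈ Ioo (0 : ℝ) 1) :
    ₂F₁ (n + β + 1) (-n - α) (β + 1 + 1) x =
      (1 - x) ^ (α + 1) * ₂F₁ (-n + 1) (n + α + β + 1 + 1) (β + 1 + 1) x := by
  rw [hypergeometric_euler _ _ (by linarith) hx.1.le hx.2,
    show β + 1 + 1 - (n + β + 1) - (-n - α) = α + 1 by ring,
    show β + 1 + 1 - (n + β + 1) = -n + 1 by ring,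
    show β + 1 + 1 - (-n - α) = n + α + β + 1 + 1 by ring]

theorem hypergeometric_euler_left (hβ : -1 < β) (hx : x ∈ Ioo (0 : ℝ) 1) :
    ₂F₁ (-n) (n + α + β + 1) (β + 1) x =
      (1 - x) ^ (-α) * ₂F₁ (n + β + 1) (-n - α) (β + 1) x := by
  rw [hypergeometric_euler _ _ (by linarith) hx.1.le hx.2,
    show β + 1 - -n - (n + α + β + 1) = -α by ring,
    show β + 1 - -n = n + β + 1 by ring,
    show β + 1 - (n + α + β + 1) = -n - α by ring]

theorem hasDerivAt_Phi_left (hβ : -1 < β) (hx : x ∈ Ioo (0 : ℝ) 1) :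
    ∃ d, HasDerivAt (Phi α β n) d x ∧
      x ^ (β + 1) * (1 - x) ^ (α + 1) * d = quasiDerivLeft α β n x := by
  refine ⟨_, (hasDerivAt_hypergeometric (-n) (n + α + β + 1) (by linarith : 0 < β + 1)
    (by rw [abs_of_pos hx.1]; exact hx.2)).congr_of_eventuallyEq ?_, ?_⟩
  · filter_upwards [Iio_mem_nhds hx.2] with y hy
    exact Phi_of_lt hy
  · rw [quasiDerivLeft, hypergeometric_euler_succ hβ hx]
    ring

/-- Differentiation lowers the third parameter from β+2 to β+1, and Euler's transformation
recognises the result as (1−x)^α Φ_n. -/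
theorem hasDerivAt_quasiDerivLeft (hβ : -1 < β) (hx : x ∈ Ioo (0 : ℝ) 1) :
    HasDerivAt (quasiDerivLeft α β n)
      (-eigenvalue α β n * (x ^ β * (1 - x) ^ α) * Phi α β n x) x := by
  have h := (hasDerivAt_rpow_mul_hypergeometric (n + β + 1) (-n - α)
    (by linarith : 0 < β + 1) hx.1 hx.2).const_mul (-n * (n + α + β + 1) / (β + 1))
  refine h.congr_deriv ?_
  have hx1 : 0 < 1 - x := by linarith [hx.2]
  have hβ' : β + 1 ≠ 0 := by linarith
  have : (1 - x) ^ (-α) * (1 - x) ^ α = 1 := by rw [← Real.rpow_add hx1]; simp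
  rw [Phi_of_lt hx.2, hypergeometric_euler_left hβ hx, eigenvalue,
    show β + 1 - 1 = β by ring]
  field_simp
  linear_combination (n * (n + α + β + 1) * x ^ β *
    ₂F₁ (n + β + 1) (-n - α) (β + 1) x) * this

theorem hasDerivAt_Phi_right (hn : 0 < 2 * n + α + β + 2) (hx : 1 < x) :
    ∃ d, HasDerivAt (Phi α β n) d x ∧
      -(x ^ (β + 1) * (x - 1) ^ (α + 1)) * d = quasiDerivRight α β n x := by
  have hx0 : 0 < x := by linarith
  obtain ⟨hu0, hu1⟩ := one_div_mem hx
  refine ⟨_, ((hasDerivAt_rpow_mul_hypergeometric_inv (n + α + β + 1) (n + α + 1) hn hx).const_mul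
    (rightConst α β n)).congr_of_eventuallyEq ?_, ?_⟩
  · filter_upwards [Ioi_mem_nhds hx] with y hy
    exact Phi_of_gt' hn hy
  · rw [quasiDerivRight, sub_one_rpow hx, hypergeometric_euler n _ hn hu0.le hu1,
      show 2 * n + α + β + 2 - n - (n + β + 1) = α + 1 by ring,
      show 2 * n + α + β + 2 - n = n + α + β + 1 + 1 by ring,
      show 2 * n + α + β + 2 - (n + β + 1) = n + α + 1 by ring]
    have e : x ^ (-n) = x ^ (β + 1) * x ^ (α + 1) * x ^ (-(n + α + β + 1) - 1) := by
      rw [← Real.rpow_add hx0, ← Real.rpow_add hx0]; ring_nf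
    rw [e]
    ring

/-- The minus sign built into the quasi-derivative makes the equation the same as on (0,1), so one
Lagrange identity serves both intervals. -/
theorem hasDerivAt_quasiDerivRight (hn : 0 < 2 * n + α + β + 2) (hx : 1 < x) :
    HasDerivAt (quasiDerivRight α β n)
      (-eigenvalue α β n * (x ^ β * (x - 1) ^ α) * Phi α β n x) x := by
  have hx0 : 0 < x := by linarith
  have h := (hasDerivAt_rpow_mul_hypergeometric_inv n (n + β + 1) hn hx).const_mul
    (rightConst α β n * (n + α + β + 1))
  refine h.congr_deriv ?_
  have e : x ^ (-n - 1) = x ^ β * x ^ (-n - β - 1) := by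
    rw [← Real.rpow_add hx0]; ring_nf
  have : (x - 1) ^ (-α) * (x - 1) ^ α = 1 := by
    rw [← Real.rpow_add (by linarith)]; simp
  rw [Phi_of_gt hx, eigenvalue, e]
  linear_combination (n * (n + α + β + 1) * x ^ β * rightConst α β n * x ^ (-n - β - 1) *
    ₂F₁ (n + 1) (n + β + 1) (2 * n + α + β + 2) (1 / x)) * this

/-- Lagrange's identity for a second order operator in Sturm–Liouville form. -/
theorem hasDerivAt_wronskian {U V DU DV : ℝ → ℝ} {dU dV P W l m : ℝ}
    (hU : HasDerivAt U dU x) (hV : HasDerivAt V dV x) (hPU : P * dU = DU x) (hPV : P * dV = DV x)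
    (hDU : HasDerivAt DU (-l * W * U x) x) (hDV : HasDerivAt DV (-m * W * V x) x) :
    HasDerivAt (fun y => U y * DV y - DU y * V y) ((l - m) * (U x * V x * W)) x := by
  refine ((hU.mul hDV).sub (hDU.mul hV)).congr_deriv ?_
  rw [← hPU, ← hPV]
  ring

/-- The boundary value of `Φ_n` at `1`, for `α < 0`. -/
noncomputable def boundaryValue (α β n : ℝ) : ℝ :=
  Real.Gamma (β + 1) * Real.Gamma (-α) / (Real.Gamma (n + β + 1) * Real.Gamma (-n - α))

/-- The limit of `quasiDerivLeft` at `1`. -/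
noncomputable def boundaryDerivLeft (α β n : ℝ) : ℝ :=
  Real.Gamma (β + 1) * Real.Gamma (α + 1) / (Real.Gamma (-n) * Real.Gamma (n + α + β + 1))

/-- The limit of `quasiDerivRight` at `1`. -/
noncomputable def boundaryDerivRight (α β n : ℝ) : ℝ :=
  Real.Gamma (β + 1) * Real.Gamma (n + 1) * Real.Gamma (α + 1) /
    (Real.Gamma (-n - α) * Real.Gamma (n + α + β + 1) * Real.Gamma (n + α + 1))

theorem tendsto_rpow_one_left (r : ℝ) : Tendsto (fun x : ℝ => x ^ r) (𝓝[<] 1) (𝓝 1) := by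
  have := (Real.continuousAt_rpow_const 1 r (Or.inl one_ne_zero)).tendsto
  rw [Real.one_rpow] at this
  exact this.mono_left nhdsWithin_le_nhds

theorem tendsto_rpow_one_right (r : ℝ) : Tendsto (fun x : ℝ => x ^ r) (𝓝[>] 1) (𝓝 1) := by
  have := (Real.continuousAt_rpow_const 1 r (Or.inl one_ne_zero)).tendsto
  rw [Real.one_rpow] at this
  exact this.mono_left nhdsWithin_le_nhds

theorem tendsto_one_div_one : Tendsto (fun x : ℝ => 1 / x) (𝓝[>] 1) (𝓝[<] 1) := by
  refine tendsto_nhdsWithin_iff.2 ⟨?_, eventually_mem_nhdsWithin.mono fun x hx => (one_div_mem hx).2⟩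
  have : Tendsto (fun x : ℝ => 1 / x) (𝓝 1) (𝓝 (1 / 1)) :=
    tendsto_const_nhds.div tendsto_id one_ne_zero
  rw [div_one] at this
  exact this.mono_left nhdsWithin_le_nhds

theorem add_natCast_ne_zero_of_pos {t : ℝ} (ht : 0 < t) (k : ℕ) : t + k ≠ 0 := by positivity

theorem Admissible.neg_add_ne_zero (h : Admissible α β n) (k : ℕ) : -n + k ≠ 0 := fun hk =>
  h.ne_int k (by push_cast; linarith)

theorem Admissible.neg_sub_add_ne_zero (h : Admissible α β n) (k : ℕ) : -n - α + k ≠ 0 := fun hk =>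
  h.add_ne_int k (by push_cast; linarith)

/-- Euler's transformation writes Φ_n as (1−x)^(−α) times a series with singular exponent −α > 0, so
the limit is a leading coefficient at 1. -/
theorem tendsto_Phi_left_one (hα : α < 0) (h : Admissible α β n) :
    Tendsto (Phi α β n) (𝓝[<] 1) (𝓝 (boundaryValue α β n)) := by
  have hβ := h.beta
  refine (tendsto_one_sub_rpow_mul_hypergeometric (by linarith : 0 < β + 1)
    (by ring : -α = (n + β + 1) + (-n - α) - (β + 1)) (by linarith)
    (add_natCast_ne_zero_of_pos h.pos₁) h.neg_sub_add_ne_zero).congr' ?_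
  filter_upwards [Ioo_mem_nhdsLT (zero_lt_one' ℝ)] with x hx
  rw [Phi_of_lt hx.2, hypergeometric_euler_left hβ hx]

theorem tendsto_quasiDerivLeft_one (hα : -1 < α) (h : Admissible α β n) :
    Tendsto (quasiDerivLeft α β n) (𝓝[<] 1) (𝓝 (boundaryDerivLeft α β n)) := by
  have hβ := h.beta
  obtain ⟨-, -, -, -, -, g6, -, g8⟩ := h.Gamma_ne_zero
  have hn0 : n ≠ 0 := by simpa using h.ne_int 0
  have hb0 : n + α + β + 1 ≠ 0 := h.pos₂.ne'
  have hc0 : β + 1 ≠ 0 := by linarith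
  have h2 := h.pos₂
  have key := (((tendsto_rpow_one_left (β + 1)).mul
    (tendsto_one_sub_rpow_mul_hypergeometric (by linarith : 0 < β + 1 + 1)
    (by ring : α + 1 = (-n + 1) + (n + α + β + 1 + 1) - (β + 1 + 1)) (by linarith)
    (fun k => by have := h.neg_add_ne_zero (k + 1); push_cast at this; convert! this using 1; ring)
    (add_natCast_ne_zero_of_pos (by linarith)))).const_mul (-n * (n + α + β + 1) / (β + 1)))
  have hlim : -n * (n + α + β + 1) / (β + 1) * (1 * (Real.Gamma (β + 1 + 1) * Real.Gamma (α + 1) /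
      (Real.Gamma (-n + 1) * Real.Gamma (n + α + β + 1 + 1)))) = boundaryDerivLeft α β n := by
    rw [Real.Gamma_add_one hc0, Real.Gamma_add_one (neg_ne_zero.2 hn0), Real.Gamma_add_one hb0,
      boundaryDerivLeft]
    field_simp
  rw [hlim] at key
  refine key.congr' ?_
  filter_upwards [Ioo_mem_nhdsLT (zero_lt_one' ℝ)] with x hx
  rw [quasiDerivLeft, hypergeometric_euler_succ hβ hx]

/-- The Gamma factors of `rightConst` are exactly those for which this limit agrees with the one
from the left. -/
theorem tendsto_Phi_right_one (hα : α < 0) (h : Admissible α β n) :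
    Tendsto (Phi α β n) (𝓝[>] 1) (𝓝 (boundaryValue α β n)) := by
  have hβ := h.beta
  have h3 := h.pos₃
  obtain ⟨g1, g2, g3, g4, g5, g6, -, g8⟩ := h.Gamma_ne_zero
  have key := ((tendsto_rpow_one_right (-n - β - 1 - α)).mul
    ((tendsto_one_sub_rpow_mul_hypergeometric (by linarith : 0 < 2 * n + α + β + 2)
    (by ring : -α = (n + 1) + (n + β + 1) - (2 * n + α + β + 2)) (by linarith)
    (fun k hk => h.ne_int (-k - 1) (by push_cast; linarith))
    (add_natCast_ne_zero_of_pos h.pos₁)).comp tendsto_one_div_one)).const_mul (rightConst α β n)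
  have hlim : rightConst α β n * (1 * (Real.Gamma (2 * n + α + β + 2) * Real.Gamma (-α) /
      (Real.Gamma (n + 1) * Real.Gamma (n + β + 1)))) = boundaryValue α β n := by
    rw [rightConst, boundaryValue]
    generalize Real.Gamma (2 * n + α + β + 2) = G at g4
    field_simp
  rw [hlim] at key
  refine key.congr' ?_
  filter_upwards [eventually_mem_nhdsWithin] with x hx
  have hx0 : 0 < x := by have : 1 < x := hx; linarith
  rw [Phi_of_gt hx, sub_one_rpow hx, sub_eq_add_neg _ α, Real.rpow_add hx0, Function.comp_apply]
  ring

theorem tendsto_quasiDerivRight_one (hα : -1 < α) (h : Admissible α β n) :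
    Tendsto (quasiDerivRight α β n) (𝓝[>] 1) (𝓝 (boundaryDerivRight α β n)) := by
  have hβ := h.beta
  have h3 := h.pos₃
  have h2 := h.pos₂
  obtain ⟨g1, g2, g3, g4, g5, g6, g7, g8⟩ := h.Gamma_ne_zero
  have hn : 0 < 2 * n + α + β + 2 := by linarith
  have key := ((tendsto_rpow_one_right (-n)).mul
    ((tendsto_one_sub_rpow_mul_hypergeometric hn
    (by ring : α + 1 = (n + α + β + 1 + 1) + (n + α + 1) - (2 * n + α + β + 2)) (by linarith)
    (add_natCast_ne_zero_of_pos (by linarith))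
    (fun k hk => h.add_ne_int (-k - 1) (by push_cast; linarith))).comp
      tendsto_one_div_one)).const_mul (rightConst α β n * (n + α + β + 1))
  have hlim : rightConst α β n * (n + α + β + 1) * (1 * (Real.Gamma (2 * n + α + β + 2) *
      Real.Gamma (α + 1) / (Real.Gamma (n + α + β + 1 + 1) * Real.Gamma (n + α + 1)))) =
      boundaryDerivRight α β n := by
    rw [Real.Gamma_add_one h2.ne', rightConst, boundaryDerivRight]
    have := h2.ne'
    generalize Real.Gamma (2 * n + α + β + 2) = G at g4
    field_simp
  rw [hlim] at key
  refine key.congr' ?_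
  filter_upwards [eventually_mem_nhdsWithin] with x hx
  obtain ⟨hu0, hu1⟩ := one_div_mem hx
  rw [quasiDerivRight, hypergeometric_euler n _ hn hu0.le hu1,
    show 2 * n + α + β + 2 - n - (n + β + 1) = α + 1 by ring,
    show 2 * n + α + β + 2 - n = n + α + β + 1 + 1 by ring,
    show 2 * n + α + β + 2 - (n + β + 1) = n + α + 1 by ring, Function.comp_apply]

theorem tendsto_hypergeometric_zero {a b c : ℝ} (hc : 0 < c) :
    Tendsto (fun x : ℝ => ₂F₁ a b c x) (𝓝 0) (𝓝 1) := by
  simpa using (continuousAt_hypergeometric a b hc (by simp : |(0 : ℝ)| < 1)).tendsto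

theorem tendsto_Phi_zero (hβ : -1 < β) : Tendsto (Phi α β n) (𝓝[>] 0) (𝓝 1) := by
  refine ((tendsto_hypergeometric_zero (a := -n) (b := n + α + β + 1)
    (by linarith : 0 < β + 1)).mono_left nhdsWithin_le_nhds).congr' ?_
  filter_upwards [Ioo_mem_nhdsGT (zero_lt_one' ℝ)] with x hx
  exact (Phi_of_lt hx.2).symm

theorem tendsto_quasiDerivLeft_zero (hβ : -1 < β) :
    Tendsto (quasiDerivLeft α β n) (𝓝[>] 0) (𝓝 0) := by
  have h1 : Tendsto (fun x : ℝ => x ^ (β + 1)) (𝓝 0) (𝓝 0) := by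
    have := (Real.continuousAt_rpow_const 0 (β + 1) (Or.inr (by linarith))).tendsto
    rwa [Real.zero_rpow (by linarith)] at this
  have := (h1.mul (tendsto_hypergeometric_zero (a := n + β + 1) (b := -n - α)
    (by linarith : 0 < β + 1 + 1))).const_mul (-n * (n + α + β + 1) / (β + 1))
  rw [zero_mul, mul_zero] at this
  exact this.mono_left nhdsWithin_le_nhds

/-- The product decays like x^(−(m+n+α+β+1)), whose exponent is negative by averaging the two
hypotheses. -/
theorem tendsto_Phi_mul_quasiDerivRight_atTop {m : ℝ} (hm : 0 < 2 * m + α + β + 1)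
    (hn : 0 < 2 * n + α + β + 1) :
    Tendsto (fun x => Phi α β m x * quasiDerivRight α β n x) atTop (𝓝 0) := by
  have hinv : Tendsto (fun x : ℝ => 1 / x) atTop (𝓝 0) := by
    simpa [one_div] using tendsto_inv_atTop_zero (𝕜 := ℝ)
  have t1 := (tendsto_hypergeometric_zero (a := m + α + β + 1) (b := m + α + 1)
    (by linarith : 0 < 2 * m + α + β + 2)).comp hinv
  have t2 := (tendsto_hypergeometric_zero (a := n) (b := n + β + 1)
    (by linarith : 0 < 2 * n + α + β + 2)).comp hinv
  have t3 := tendsto_rpow_neg_atTop (by linarith : 0 < m + n + α + β + 1)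
  have key := (((t3.mul t1).mul t2).const_mul
    (rightConst α β m * rightConst α β n * (n + α + β + 1)))
  simp only [zero_mul, mul_zero] at key
  refine key.congr' ?_
  filter_upwards [eventually_gt_atTop 1] with x hx
  have hx0 : 0 < x := by linarith
  rw [Phi_of_gt' (by linarith) hx, quasiDerivRight, Function.comp_apply, Function.comp_apply,
    show -(m + n + α + β + 1) = -(m + α + β + 1) + -n by ring, Real.rpow_add hx0]
  ring

end

/-! ### Orthogonality and norms for α < 0. -/

section

variable {α β θ m n x : ℝ}

/-- The ratio of the two normalizations of the weight. -/
noncomputable def weightRatio (α θ : ℝ) : ℝ :=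
  Real.sin (Real.pi * θ) / Real.sin (Real.pi * (α + θ))

/-- The bilinear form `∫ Φ_m Φ_n w`. -/
noncomputable def pairing (α β θ m n : ℝ) : ℝ :=
  ∫ x in Ioi (0 : ℝ), Phi α β m x * Phi α β n x * weight α β θ x

theorem sin_pi_mul_pos {t : ℝ} (h0 : 0 < t) (h1 : t < 1) : 0 < Real.sin (Real.pi * t) :=
  Real.sin_pos_of_pos_of_lt_pi (by positivity) (by nlinarith [Real.pi_pos])

theorem eigenvalue_sub (α β m n : ℝ) :
    eigenvalue α β m - eigenvalue α β n = (m - n) * (m + n + α + β + 1) := by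
  rw [eigenvalue, eigenvalue]
  ring

/-- Lagrange's identity integrated over (0,1). Nothing comes from 0, where the quasi-derivatives
vanish and Φ tends to 1. -/
theorem integral_left (hα₀ : -1 < α) (hα : α < 0) (hm : Admissible α β m) (hn : Admissible α β n)
    (hint : IntegrableOn (fun x => Phi α β m x * Phi α β n x * (x ^ β * (1 - x) ^ α)) (Ioo 0 1)) :
    (eigenvalue α β m - eigenvalue α β n) *
      ∫ x in Ioo (0 : ℝ) 1, Phi α β m x * Phi α β n x * (x ^ β * (1 - x) ^ α) =
      boundaryValue α β m * boundaryDerivLeft α β n -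
        boundaryDerivLeft α β m * boundaryValue α β n := by
  have hβ := hm.beta
  have hderiv : ∀ x ∈ Ioo (0 : ℝ) 1, HasDerivAt
      (fun y => Phi α β m y * quasiDerivLeft α β n y - quasiDerivLeft α β m y * Phi α β n y)
      ((eigenvalue α β m - eigenvalue α β n) *
        (Phi α β m x * Phi α β n x * (x ^ β * (1 - x) ^ α))) x := by
    intro x hx
    obtain ⟨dm, hdm, em⟩ := hasDerivAt_Phi_left (α := α) (n := m) hβ hx
    obtain ⟨dn, hdn, en⟩ := hasDerivAt_Phi_left (α := α) (n := n) hβ hx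
    exact hasDerivAt_wronskian hdm hdn em en (hasDerivAt_quasiDerivLeft hβ hx)
      (hasDerivAt_quasiDerivLeft hβ hx)
  have h0 := ((tendsto_Phi_zero (α := α) (n := m) hβ).mul
    (tendsto_quasiDerivLeft_zero (α := α) (n := n) hβ)).sub
    ((tendsto_quasiDerivLeft_zero (α := α) (n := m) hβ).mul
    (tendsto_Phi_zero (α := α) (n := n) hβ))
  have h1 := ((tendsto_Phi_left_one hα hm).mul (tendsto_quasiDerivLeft_one hα₀ hn)).sub
    ((tendsto_quasiDerivLeft_one hα₀ hm).mul (tendsto_Phi_left_one hα hn))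
  have key := intervalIntegral.integral_eq_sub_of_hasDerivAt_of_tendsto zero_lt_one hderiv
    ((intervalIntegrable_iff_integrableOn_Ioo_of_le zero_le_one).2 (hint.const_mul _)) h0 h1
  rw [intervalIntegral.integral_of_le zero_le_one, integral_Ioc_eq_integral_Ioo,
    integral_const_mul] at key
  rw [key]
  ring

theorem integral_right (hα₀ : -1 < α) (hα : α < 0) (hm : Admissible α β m)
    (hn : Admissible α β n)
    (hint : IntegrableOn (fun x => Phi α β m x * Phi α β n x * (x ^ β * (x - 1) ^ α)) (Ioi 1)) :
    (eigenvalue α β m - eigenvalue α β n) *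
      ∫ x in Ioi (1 : ℝ), Phi α β m x * Phi α β n x * (x ^ β * (x - 1) ^ α) =
      boundaryDerivRight α β m * boundaryValue α β n -
        boundaryValue α β m * boundaryDerivRight α β n := by
  have hm3 := hm.pos₃
  have hn3 := hn.pos₃
  have hm' : 0 < 2 * m + α + β + 2 := by linarith
  have hn' : 0 < 2 * n + α + β + 2 := by linarith
  set f : ℝ → ℝ := fun y =>
    Phi α β m y * quasiDerivRight α β n y - quasiDerivRight α β m y * Phi α β n y with hf
  set L := boundaryValue α β m * boundaryDerivRight α β n -
    boundaryDerivRight α β m * boundaryValue α β n with hL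
  -- The value of f at 1 itself is arbitrary; it is replaced by the right limit L to get continuity
  -- up to the endpoint.
  have hderiv : ∀ x ∈ Ioi (1 : ℝ), HasDerivAt (Function.update f 1 L)
      ((eigenvalue α β m - eigenvalue α β n) *
        (Phi α β m x * Phi α β n x * (x ^ β * (x - 1) ^ α))) x := by
    intro x hx
    obtain ⟨dm, hdm, em⟩ := hasDerivAt_Phi_right hm' hx
    obtain ⟨dn, hdn, en⟩ := hasDerivAt_Phi_right hn' hx
    refine (hasDerivAt_wronskian hdm hdn em en (hasDerivAt_quasiDerivRight hm' hx)
      (hasDerivAt_quasiDerivRight hn' hx)).congr_of_eventuallyEq ?_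
    filter_upwards [Ioi_mem_nhds (show (1 : ℝ) < x from hx)] with y hy
    exact Function.update_of_ne (ne_of_gt hy) _ _
  have h1 : Tendsto f (𝓝[>] 1) (𝓝 L) :=
    ((tendsto_Phi_right_one hα hm).mul (tendsto_quasiDerivRight_one hα₀ hn)).sub
    ((tendsto_quasiDerivRight_one hα₀ hm).mul (tendsto_Phi_right_one hα hn))
  have hcont : ContinuousWithinAt (Function.update f 1 L) (Ici 1) 1 := by
    rw [continuousWithinAt_update_same, Ici_sdiff_left]
    exact h1
  have hinf : Tendsto (Function.update f 1 L) atTop (𝓝 0) := by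
    have := (tendsto_Phi_mul_quasiDerivRight_atTop hm3 hn3).sub
      (tendsto_Phi_mul_quasiDerivRight_atTop hn3 hm3)
    rw [sub_zero] at this
    refine this.congr' ?_
    filter_upwards [eventually_gt_atTop 1] with y hy
    rw [Function.update_of_ne (ne_of_gt hy), hf]
    ring
  have key := integral_Ioi_of_hasDerivAt_of_tendsto hcont hderiv (hint.const_mul _) hinf
  rw [integral_const_mul, Function.update_self] at key
  rw [key, hL]
  ring

theorem pairing_eq_add (hα : |α| < 1) (hm : Admissible α β m) (hn : Admissible α β n)
    (hθ : Real.sin (Real.pi * θ) ≠ 0) (hθα : Real.sin (Real.pi * (α + θ)) ≠ 0) :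
    IntegrableOn (fun x => Phi α β m x * Phi α β n x * (x ^ β * (1 - x) ^ α)) (Ioo 0 1) ∧
    IntegrableOn (fun x => Phi α β m x * Phi α β n x * (x ^ β * (x - 1) ^ α)) (Ioi 1) ∧
    pairing α β θ m n =
      (∫ x in Ioo (0 : ℝ) 1, Phi α β m x * Phi α β n x * (x ^ β * (1 - x) ^ α)) +
      weightRatio α θ * ∫ x in Ioi (1 : ℝ), Phi α β m x * Phi α β n x * (x ^ β * (x - 1) ^ α) := by
  have h := integrableOn_Phi_mul_Phi hα hm hn hθα
  have hL : EqOn (fun x => Phi α β m x * Phi α β n x * weight α β θ x)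
      (fun x => Phi α β m x * Phi α β n x * (x ^ β * (1 - x) ^ α)) (Ioo 0 1) := fun x hx => by
    simp only [weight, if_pos hx.2]
  have hR : EqOn (fun x => Phi α β m x * Phi α β n x * weight α β θ x)
      (fun x => weightRatio α θ * (Phi α β m x * Phi α β n x * (x ^ β * (x - 1) ^ α)))
      (Ioi 1) := fun x hx => by
    simp only [weight, if_neg (show 1 < x from hx).not_gt, weightRatio]
    ring
  rw [integrableOn_congr_set_ae Ioi_zero_ae_eq, integrableOn_union] at h
  have hk : weightRatio α θ ≠ 0 := div_ne_zero hθ hθα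
  refine ⟨h.1.congr_fun hL measurableSet_Ioo, ?_, ?_⟩
  · exact IntegrableOn.congr_fun ((h.2.congr_fun hR measurableSet_Ioi).const_mul
      (weightRatio α θ)⁻¹) (fun x _ => by rw [inv_mul_cancel_left₀ hk]) measurableSet_Ioi
  · rw [pairing, setIntegral_congr_set Ioi_zero_ae_eq, setIntegral_union
      (Set.disjoint_left.2 fun x hx hx' => hx.2.not_gt hx') measurableSet_Ioi h.1 h.2,
      setIntegral_congr_fun measurableSet_Ioo hL, setIntegral_congr_fun measurableSet_Ioi hR,
      integral_const_mul]

/-- The defect in the matching condition at `1` for the derivatives of the two branches. -/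
noncomputable def matchingDefect (α β θ n : ℝ) : ℝ :=
  boundaryDerivLeft α β n - weightRatio α θ * boundaryDerivRight α β n

/-- The values of Φ at 1 agree from both sides, so they factor out of the two boundary
contributions. Neither m nor n need lie on the lattice, which the norm computation exploits. -/
theorem eigenvalue_sub_mul_pairing (hα₀ : -1 < α) (hα : α < 0) (hm : Admissible α β m)
    (hn : Admissible α β n) (hθ : Real.sin (Real.pi * θ) ≠ 0)
    (hθα : Real.sin (Real.pi * (α + θ)) ≠ 0) :
    (eigenvalue α β m - eigenvalue α β n) * pairing α β θ m n =
      boundaryValue α β m * matchingDefect α β θ n -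
        boundaryValue α β n * matchingDefect α β θ m := by
  obtain ⟨i1, i2, e⟩ := pairing_eq_add (abs_lt.2 ⟨hα₀, by linarith⟩) hm hn hθ hθα
  rw [e, matchingDefect, matchingDefect]
  linear_combination integral_left hα₀ hα hm hn i1 +
    weightRatio α θ * integral_right hα₀ hα hm hn i2

/-- The trigonometric factor of `matchingDefect`. -/
noncomputable def matchingSine (α θ n : ℝ) : ℝ :=
  Real.sin (Real.pi * n) - weightRatio α θ * Real.sin (Real.pi * (n + α))

/-- The nonvanishing factor of `matchingDefect`. -/
noncomputable def matchingFactor (α β n : ℝ) : ℝ :=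
  -(Real.Gamma (β + 1) * Real.Gamma (α + 1) * Real.Gamma (n + 1)) /
    (Real.pi * Real.Gamma (n + α + β + 1))

theorem Gamma_neg_mul (s : ℝ) :
    Real.Gamma (-s) * Real.Gamma (s + 1) = -(Real.pi / Real.sin (Real.pi * s)) := by
  have := Real.Gamma_mul_Gamma_one_sub (-s)
  rw [sub_neg_eq_add, add_comm 1 s, mul_neg, Real.sin_neg, div_neg] at this
  exact this

theorem inv_Gamma_neg (s : ℝ) (h : Real.Gamma (-s) ≠ 0) (h' : Real.Gamma (s + 1) ≠ 0) :
    (Real.Gamma (-s))⁻¹ = -(Real.Gamma (s + 1) * Real.sin (Real.pi * s) / Real.pi) := by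
  have := Gamma_neg_mul s
  have hs : Real.sin (Real.pi * s) ≠ 0 := by
    intro h0
    rw [h0, div_zero, neg_zero] at this
    exact mul_ne_zero h h' this
  have hpi := Real.pi_ne_zero
  rw [inv_eq_iff_eq_inv]
  field_simp at this ⊢
  linear_combination this

/-- The reflection formula replaces 1/Γ(−n) and 1/Γ(−n−α) by sines; the remaining Gamma factors are
common to both sides of 1. -/
theorem matchingDefect_eq (h : Admissible α β n) :
    matchingDefect α β θ n = matchingFactor α β n * matchingSine α θ n := by
  obtain ⟨g1, g2, g3, g4, g5, g6, g7, g8⟩ := h.Gamma_ne_zero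
  have e1 := inv_Gamma_neg n g8 g2
  have e2 := inv_Gamma_neg (n + α) (by rwa [neg_add']) g7
  rw [neg_add'] at e2
  have hpi := Real.pi_ne_zero
  rw [matchingDefect, boundaryDerivLeft, boundaryDerivRight, matchingFactor, matchingSine]
  rw [div_eq_mul_inv, div_eq_mul_inv, mul_inv, mul_inv, mul_inv, e1, e2]
  field_simp
  ring

theorem sin_pi_mul_of_sub_int {t : ℝ} {k : ℤ} (h : n - θ = k) :
    Real.sin (Real.pi * (n + t)) = (-1) ^ k * Real.sin (Real.pi * (t + θ)) := by
  rw [show Real.pi * (n + t) = Real.pi * (t + θ) + k * Real.pi by rw [← h]; ring,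
    Real.sin_add_int_mul_pi]

/-- Passing from θ to n multiplies both sines by the same sign, and at θ they cancel by the choice
of the weight ratio. -/
theorem matchingSine_eq_zero (hn : ∃ k : ℤ, n - θ = k)
    (hθα : Real.sin (Real.pi * (α + θ)) ≠ 0) : matchingSine α θ n = 0 := by
  obtain ⟨k, hk⟩ := hn
  have h0 := sin_pi_mul_of_sub_int (t := 0) hk
  rw [add_zero, zero_add] at h0
  rw [matchingSine, h0, sin_pi_mul_of_sub_int hk, weightRatio]
  field_simp
  ring

theorem pairing_eq_zero_of_neg (hα₀ : -1 < α) (hα : α < 0) (hm : Admissible α β m)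
    (hn : Admissible α β n) (hmθ : ∃ k : ℤ, m - θ = k) (hnθ : ∃ k : ℤ, n - θ = k) (hmn : m ≠ n)
    (hθ : Real.sin (Real.pi * θ) ≠ 0) (hθα : Real.sin (Real.pi * (α + θ)) ≠ 0) :
    pairing α β θ m n = 0 := by
  have h := eigenvalue_sub_mul_pairing hα₀ hα hm hn hθ hθα
  rw [matchingDefect_eq hm, matchingDefect_eq hn, matchingSine_eq_zero hmθ hθα,
    matchingSine_eq_zero hnθ hθα, eigenvalue_sub] at h
  simp only [mul_zero, sub_zero] at h
  have h1 := hm.pos₃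
  have h2 := hn.pos₃
  have : (m - n) * (m + n + α + β + 1) ≠ 0 :=
    mul_ne_zero (sub_ne_zero.2 hmn) (by linarith)
  exact (mul_eq_zero.1 h).resolve_left this

theorem Admissible.eventually (h : Admissible α β n) : ∀ᶠ m in 𝓝 n, Admissible α β m := by
  have hZ : IsOpen {t : ℝ | ∀ k : ℤ, t ≠ k} := by
    have := Int.isClosedEmbedding_coe_real.isClosed_range.isOpen_compl
    convert! this using 1
    ext t
    simp [eq_comm]
  have e1 : ∀ᶠ m : ℝ in 𝓝 n, ∀ k : ℤ, m ≠ k := hZ.mem_nhds h.ne_int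
  have e2 : ∀ᶠ m : ℝ in 𝓝 n, ∀ k : ℤ, m + α ≠ k :=
    (tendsto_id.add_const α).eventually (hZ.mem_nhds h.add_ne_int)
  have h1 := h.pos₁
  have h2 := h.pos₂
  have h3 := h.pos₃
  filter_upwards [e1, e2, Ioi_mem_nhds (by linarith : -β - 1 < n),
    Ioi_mem_nhds (by linarith : -α - β - 1 < n),
    Ioi_mem_nhds (by linarith : (-α - β - 1) / 2 < n)] with m m1 m2 m3 m4 m5
  rw [mem_Ioi] at m3 m4 m5
  exact ⟨m1, m2, h.beta, by linarith, by linarith, by linarith⟩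

/-- The squared norm of `Φ_n`. -/
noncomputable def normSqFormula (α β n : ℝ) : ℝ :=
  Real.Gamma (β + 1) ^ 2 * Real.Gamma (1 + n) * Real.Gamma (1 + n + α) /
    ((α + β + 2 * n + 1) * Real.Gamma (β + 1 + n) * Real.Gamma (n + α + β + 1))

/-- With n on the lattice, only the defect at m survives in `eigenvalue_sub_mul_pairing`. Division
by m − n turns its sine factor into a difference quotient, and m → n is legitimate since the pairing
is continuous in m. -/
theorem pairing_self_eq_of_neg_aux (hα₀ : -1 < α) (hα : α < 0) (hn : Admissible α β n)
    (hnθ : ∃ k : ℤ, n - θ = k) (hθ : Real.sin (Real.pi * θ) ≠ 0)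
    (hθα : Real.sin (Real.pi * (α + θ)) ≠ 0) :
    pairing α β θ n n = -(boundaryValue α β n * matchingFactor α β n *
      (Real.pi * (Real.cos (Real.pi * n) - weightRatio α θ * Real.cos (Real.pi * (n + α))))) /
      (2 * n + α + β + 1) := by
  have hn3 := hn.pos₃
  have hid : Tendsto (fun m : ℝ => m) (𝓝[≠] n) (𝓝 n) := tendsto_id.mono_left nhdsWithin_le_nhds
  have t1 : Tendsto (fun m => pairing α β θ m n) (𝓝[≠] n) (𝓝 (pairing α β θ n n)) :=
    tendsto_integral_Phi_mul_Phi (abs_lt.2 ⟨hα₀, by linarith⟩) hn hn hθα tendsto_const_nhds hid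
      tendsto_const_nhds
  have hder : HasDerivAt (matchingSine α θ)
      (Real.pi * (Real.cos (Real.pi * n) - weightRatio α θ * Real.cos (Real.pi * (n + α)))) n := by
    have d1 := ((hasDerivAt_id n).const_mul Real.pi).sin
    have d2 := ((((hasDerivAt_id n).add_const α).const_mul Real.pi).sin).const_mul
      (weightRatio α θ)
    refine (d1.sub d2).congr_deriv ?_
    simp only [id]
    ring
  have t2 := hasDerivAt_iff_tendsto_slope.1 hder
  have t3 : Tendsto (matchingFactor α β) (𝓝[≠] n) (𝓝 (matchingFactor α β n)) := by
    obtain ⟨g1, g2, g3, g4, g5, g6, g7, g8⟩ := hn.Gamma_ne_zero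
    have c1 : ContinuousAt (fun m => Real.Gamma (m + 1)) n :=
      ContinuousAt.comp (f := fun m : ℝ => m + 1) (continuousAt_Gamma_of_ne_zero g2) (by fun_prop)
    have c2 : ContinuousAt (fun m => Real.Gamma (m + α + β + 1)) n :=
      ContinuousAt.comp (f := fun m : ℝ => m + α + β + 1) (continuousAt_Gamma_of_ne_zero g6)
        (by fun_prop)
    have : ContinuousAt (matchingFactor α β) n :=
      ((continuousAt_const.mul c1).neg).div (continuousAt_const.mul c2)
        (mul_ne_zero Real.pi_ne_zero g6)
    exact this.tendsto.mono_left nhdsWithin_le_nhds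
  have t4 : Tendsto (fun m => m + n + α + β + 1) (𝓝[≠] n) (𝓝 (n + n + α + β + 1)) :=
    (((hid.add_const n).add_const α).add_const β).add_const 1
  have t5 := (((t3.mul t2).const_mul (boundaryValue α β n)).neg).div t4 (by linarith)
  refine tendsto_nhds_unique t1 ?_
  rw [show 2 * n + α + β + 1 = n + n + α + β + 1 by ring, mul_assoc]
  refine t5.congr' ?_
  filter_upwards [eventually_mem_nhdsWithin, nhdsWithin_le_nhds hn.eventually] with m hmn hm
  have hm3 := hm.pos₃
  have hmn' : m - n ≠ 0 := sub_ne_zero.2 hmn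
  have h := eigenvalue_sub_mul_pairing hα₀ hα hm hn hθ hθα
  have hz := matchingSine_eq_zero hnθ hθα
  rw [matchingDefect_eq hm, matchingDefect_eq hn, hz, eigenvalue_sub] at h
  have hp : m + n + α + β + 1 ≠ 0 := by linarith
  rw [Pi.div_apply, slope_def_field, hz, sub_zero, div_eq_iff hp]
  field_simp
  linear_combination -h

theorem pairing_self_eq_of_neg (hα₀ : -1 < α) (hα : α < 0) (hn : Admissible α β n)
    (hnθ : ∃ k : ℤ, n - θ = k) (hθ : Real.sin (Real.pi * θ) ≠ 0)
    (hθα : Real.sin (Real.pi * (α + θ)) ≠ 0) :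
    pairing α β θ n n = normSqFormula α β n := by
  rw [pairing_self_eq_of_neg_aux hα₀ hα hn hnθ hθ hθα]
  obtain ⟨g1, g2, g3, g4, g5, g6, g7, g8⟩ := hn.Gamma_ne_zero
  have hn3 := hn.pos₃
  have hs : Real.sin (Real.pi * (n + α)) ≠ 0 := by
    obtain ⟨k, hk⟩ := hnθ
    rw [sin_pi_mul_of_sub_int hk]
    exact mul_ne_zero (zpow_ne_zero _ (by norm_num)) hθα
  have hk : weightRatio α θ = Real.sin (Real.pi * n) / Real.sin (Real.pi * (n + α)) := by
    rw [eq_div_iff hs]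
    have := matchingSine_eq_zero hnθ hθα
    rw [matchingSine] at this
    linarith
  have hα1 : Real.sin (Real.pi * α) ≠ 0 := by
    have := sin_pi_mul_pos (t := -α) (by linarith) (by linarith)
    rw [mul_neg, Real.sin_neg] at this
    linarith
  have hcos : Real.cos (Real.pi * n) - weightRatio α θ * Real.cos (Real.pi * (n + α)) =
      Real.sin (Real.pi * α) / Real.sin (Real.pi * (n + α)) := by
    rw [hk, eq_div_iff hs, show Real.pi * α = Real.pi * (n + α) - Real.pi * n by ring, Real.sin_sub]
    field_simp
  have e2 := inv_Gamma_neg (n + α) (by rwa [neg_add']) g7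
  rw [neg_add'] at e2
  have e3 := Gamma_neg_mul α
  have hpi := Real.pi_ne_zero
  rw [hcos, boundaryValue, matchingFactor, normSqFormula, div_eq_mul_inv _ (_ * Real.Gamma (-n - α)),
    mul_inv, e2, show 1 + n + α = n + α + 1 by ring, show 1 + n = n + 1 by ring,
    show β + 1 + n = n + β + 1 by ring, show α + β + 2 * n + 1 = 2 * n + α + β + 1 by ring]
  -- The Γ(−α) of the boundary value and the Γ(α+1) of the matching factor disappear against sin πα,
  -- which the cosine difference supplied.
  have e4 : Real.sin (Real.pi * α) * (Real.Gamma (-α) * Real.Gamma (α + 1)) = -Real.pi := by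
    rw [e3]; field_simp
  generalize 2 * n + α + β + 1 = D at *
  generalize Real.sin (Real.pi * (n + α)) = S at *
  generalize Real.sin (Real.pi * α) = T at *
  have hD : D ≠ 0 := hn3.ne'
  field_simp
  linear_combination (-1 : ℝ) * e4

end

/-! ### The symmetry α ↦ −α, the case α = 0, and passage to L². -/

section

variable {α β θ m n x : ℝ}

theorem Admissible.neg (h : Admissible α β n) : Admissible (-α) β (n + α) := by
  have h1 := h.pos₁
  have h2 := h.pos₂
  have h3 := h.pos₃
  refine ⟨h.add_ne_int, fun k => ?_, h.beta, by linarith, by linarith, by linarith⟩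
  rw [add_neg_cancel_right]
  exact h.ne_int k

theorem Phi_neg_of_lt (hβ : -1 < β) (hx : x ∈ Ioo (0 : ℝ) 1) :
    Phi α β n x = (1 - x) ^ (-α) * Phi (-α) β (n + α) x := by
  rw [Phi_of_lt hx.2, Phi_of_lt hx.2, hypergeometric_euler_left hβ hx, hypergeometric_comm,
    show -(n + α) = -n - α by ring, show n + α + -α + β + 1 = n + β + 1 by ring]

theorem Phi_neg_of_gt (hn : 0 < 2 * n + α + β + 2) (hx : 1 < x)
    (hk : rightConst α β n * weightRatio α θ = rightConst (-α) β (n + α)) :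
    weightRatio α θ * Phi α β n x = (x - 1) ^ (-α) * Phi (-α) β (n + α) x := by
  rw [Phi_of_gt hx, Phi_of_gt' (by linarith) hx, hypergeometric_comm (n + 1), ← hk,
    show n + α + -α + β + 1 = n + β + 1 by ring, show n + α + -α + 1 = n + 1 by ring,
    show 2 * (n + α) + -α + β + 2 = 2 * n + α + β + 2 by ring,
    show -n - β - 1 = -(n + β + 1) by ring]
  ring

/-- By reflection, the quotient of the two constants is a quotient of sines at n and n+α; on the
lattice it equals the weight ratio. -/
theorem rightConst_mul_weightRatio (h : Admissible α β n) (hn : ∃ k : ℤ, n - θ = k)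
    (hθα : Real.sin (Real.pi * (α + θ)) ≠ 0) :
    rightConst α β n * weightRatio α θ = rightConst (-α) β (n + α) := by
  obtain ⟨g1, g2, g3, g4, g5, g6, g7, g8⟩ := h.Gamma_ne_zero
  have e1 := inv_Gamma_neg n g8 g2
  have e2 := inv_Gamma_neg (n + α) (by rwa [neg_add']) g7
  rw [neg_add'] at e2
  have hz := matchingSine_eq_zero hn hθα
  rw [matchingSine] at hz
  rw [rightConst, rightConst, show -(n + α) - -α = -n by ring,
    show 2 * (n + α) + -α + β + 2 = 2 * n + α + β + 2 by ring, div_eq_mul_inv, div_eq_mul_inv,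
    mul_inv, mul_inv, e1, e2]
  linear_combination (Real.Gamma (β + 1) * Real.Gamma (n + 1) * Real.Gamma (n + α + 1) / Real.pi *
    (Real.Gamma (2 * n + α + β + 2))⁻¹) * hz

/-- Each Φ contributes |1−x|^(−α), and with |1−x|^α from the weight this leaves the weight exponent
−α; beyond 1 the weight ratio is inverted. -/
theorem pairing_neg (hm : Admissible α β m) (hn : Admissible α β n) (hmθ : ∃ k : ℤ, m - θ = k)
    (hnθ : ∃ k : ℤ, n - θ = k) (hθ : Real.sin (Real.pi * θ) ≠ 0)
    (hθα : Real.sin (Real.pi * (α + θ)) ≠ 0) :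
    pairing α β θ m n = pairing (-α) β (θ + α) (m + α) (n + α) := by
  have hm3 := hm.pos₃
  have hn3 := hn.pos₃
  refine setIntegral_congr_ae measurableSet_Ioi ?_
  have hne : ∀ᵐ x : ℝ, x ≠ 1 := by simp [ae_iff]
  filter_upwards [hne] with x hx1 hx0
  have hx0 : 0 < x := hx0
  rcases lt_or_gt_of_ne hx1 with hx | hx
  · have h1 : 0 < 1 - x := by linarith
    have e : (1 - x) ^ (-α) * (1 - x) ^ α = 1 := by rw [← Real.rpow_add h1]; simp
    have em := Phi_neg_of_lt (α := α) (n := m) hm.beta ⟨hx0, hx⟩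
    have en := Phi_neg_of_lt (α := α) (n := n) hn.beta ⟨hx0, hx⟩
    rw [em, en, weight, weight, if_pos hx,
      if_pos hx]
    linear_combination (Phi (-α) β (m + α) x * Phi (-α) β (n + α) x * x ^ β *
      (1 - x) ^ (-α)) * e
  · have hk : weightRatio α θ ≠ 0 := div_ne_zero hθ hθα
    have em := Phi_neg_of_gt (by linarith) hx (rightConst_mul_weightRatio hm hmθ hθα)
    have en := Phi_neg_of_gt (by linarith) hx (rightConst_mul_weightRatio hn hnθ hθα)
    have e : (x - 1) ^ (-α) * (x - 1) ^ α = 1 := by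
      rw [← Real.rpow_add (by linarith)]; simp
    have ew : Real.sin (Real.pi * (θ + α)) / Real.sin (Real.pi * (-α + (θ + α))) =
        (weightRatio α θ)⁻¹ := by
      rw [weightRatio, inv_div, add_comm θ α, neg_add_cancel_left]
    rw [weight, weight, if_neg hx.not_gt, if_neg hx.not_gt, ew]
    change _ * _ * (weightRatio α θ * _) = _
    -- One more weight ratio, besides the one in the weight, provides a factor for each of Φ_m and
    -- Φ_n, as `Phi_neg_of_gt` requires.
    refine mul_left_cancel₀ hk ?_
    calc _ = (weightRatio α θ * Phi α β m x) * (weightRatio α θ * Phi α β n x) *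
          (x ^ β * (x - 1) ^ α) := by ring
      _ = (Phi (-α) β (m + α) x * Phi (-α) β (n + α) x * (x ^ β * (x - 1) ^ (-α))) *
          ((x - 1) ^ (-α) * (x - 1) ^ α) := by rw [em, en]; ring
      _ = _ := by rw [e]; field_simp

theorem normSqFormula_neg : normSqFormula (-α) β (n + α) = normSqFormula α β n := by
  rw [normSqFormula, normSqFormula, show 1 + (n + α) + -α = 1 + n by ring,
    show -α + β + 2 * (n + α) + 1 = α + β + 2 * n + 1 by ring,
    show β + 1 + (n + α) = n + α + β + 1 by ring, show n + α + -α + β + 1 = β + 1 + n by ring,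
    show 1 + (n + α) = 1 + n + α by ring]
  ring

theorem tendsto_normSqFormula_zero (hn : Admissible 0 β n) :
    Tendsto (fun a => normSqFormula a β n) (𝓝[<] 0) (𝓝 (normSqFormula 0 β n)) := by
  obtain ⟨g1, g2, g3, g4, g5, g6, g7, g8⟩ := hn.Gamma_ne_zero
  have c1 : ContinuousAt (fun a => Real.Gamma (1 + n + a)) 0 :=
    ContinuousAt.comp (f := fun a : ℝ => 1 + n + a) (continuousAt_Gamma_of_ne_zero
      (by convert g7 using 2; ring)) (by fun_prop)
  have c2 : ContinuousAt (fun a => Real.Gamma (n + a + β + 1)) 0 :=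
    ContinuousAt.comp (f := fun a : ℝ => n + a + β + 1) (continuousAt_Gamma_of_ne_zero g6)
      (by fun_prop)
  have h3 := hn.pos₃
  have : ContinuousAt (fun a => normSqFormula a β n) 0 := by
    refine (continuousAt_const.mul c1).div
      ((ContinuousAt.mul (by fun_prop) continuousAt_const).mul c2) ?_
    refine mul_ne_zero (mul_ne_zero (by linarith) ?_) g6
    convert g5 using 2
    ring
  exact this.tendsto.mono_left nhdsWithin_le_nhds

/-- The parameter restrictions of the perturbed Jacobi system. -/
structure Parameters (α β θ : ℝ) : Prop where
  alpha_gt : -1 < α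
  alpha_lt : α < 1
  beta : -1 < β
  theta_pos : 0 < θ
  theta_lt : θ < 1
  sum_pos : 0 < θ + α
  sum_lt : θ + α < 1

theorem Parameters.admissible (h : Parameters α β θ) (hn : n ∈ indexSet α β θ) :
    Admissible α β n :=
  admissible_of_mem_indexSet h.beta h.theta_pos h.theta_lt h.sum_pos h.sum_lt hn

theorem Parameters.abs_alpha (h : Parameters α β θ) : |α| < 1 := abs_lt.2 ⟨h.alpha_gt, h.alpha_lt⟩

theorem Parameters.sin_theta_pos (h : Parameters α β θ) : 0 < Real.sin (Real.pi * θ) :=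
  sin_pi_mul_pos h.theta_pos h.theta_lt

theorem Parameters.sin_sum_pos (h : Parameters α β θ) : 0 < Real.sin (Real.pi * (α + θ)) := by
  rw [add_comm]
  exact sin_pi_mul_pos h.sum_pos h.sum_lt

theorem Parameters.neg (h : Parameters α β θ) : Parameters (-α) β (θ + α) := by
  obtain ⟨h1, h2, h3, h4, h5, h6, h7⟩ := h
  constructor <;> linarith

theorem mem_indexSet_neg (hn : n ∈ indexSet α β θ) : n + α ∈ indexSet (-α) β (θ + α) := by
  obtain ⟨⟨k, hk⟩, hpos⟩ := hn
  exact ⟨⟨k, by rw [← hk]; ring⟩, by linarith⟩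

theorem pairing_eq_of_neg (h : Parameters α β θ) (hα : α < 0) (hm : m ∈ indexSet α β θ)
    (hn : n ∈ indexSet α β θ) :
    pairing α β θ m n = if m = n then normSqFormula α β n else 0 := by
  have hs := h.sin_theta_pos.ne'
  have hs' := h.sin_sum_pos.ne'
  split_ifs with hmn
  · rw [hmn]
    exact pairing_self_eq_of_neg h.alpha_gt hα (h.admissible hn) hn.1 hs hs'
  · exact pairing_eq_zero_of_neg h.alpha_gt hα (h.admissible hm) (h.admissible hn) hm.1 hn.1 hmn
      hs hs'

/-- The orthogonality relations for the functions `Φ_n`. -/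
theorem pairing_eq (h : Parameters α β θ) (hm : m ∈ indexSet α β θ) (hn : n ∈ indexSet α β θ) :
    pairing α β θ m n = if m = n then normSqFormula α β n else 0 := by
  have hs := h.sin_theta_pos.ne'
  have hs' := h.sin_sum_pos.ne'
  rcases lt_trichotomy α 0 with hα | rfl | hα
  · exact pairing_eq_of_neg h hα hm hn
  · have hid : Tendsto (fun a : ℝ => a) (𝓝[<] 0) (𝓝 0) := tendsto_id.mono_left nhdsWithin_le_nhds
    have t1 : Tendsto (fun a => pairing a β θ m n) (𝓝[<] 0) (𝓝 (pairing 0 β θ m n)) :=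
      tendsto_integral_Phi_mul_Phi (by simp) (h.admissible hm) (h.admissible hn) hs' hid
        tendsto_const_nhds tendsto_const_nhds
    have t2 : Tendsto (fun a => if m = n then normSqFormula a β n else 0) (𝓝[<] 0)
        (𝓝 (if m = n then normSqFormula 0 β n else 0)) := by
      split_ifs
      · exact tendsto_normSqFormula_zero (h.admissible hn)
      · exact tendsto_const_nhds
    refine tendsto_nhds_unique t1 (t2.congr' ?_)
    obtain ⟨-, -, hβ, hθ0, hθ1, -, -⟩ := h
    have hm2 := hm.2
    have hn2 := hn.2
    -- With m, n and θ fixed, the parameter and index conditions are open in α, so the negative case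
    -- applies to all a < 0 close to 0.
    filter_upwards [eventually_mem_nhdsWithin,
      nhdsWithin_le_nhds (Ioi_mem_nhds (by linarith : (-1 : ℝ) < 0)),
      nhdsWithin_le_nhds (Ioi_mem_nhds (by linarith : -θ < 0)),
      nhdsWithin_le_nhds (Ioi_mem_nhds (by linarith : -(2 * m + β + 1) < 0)),
      nhdsWithin_le_nhds (Ioi_mem_nhds (by linarith : -(2 * n + β + 1) < 0))]
      with a a1 a2 a3 a4 a5
    rw [mem_Iio] at a1
    rw [mem_Ioi] at a2 a3 a4 a5
    refine (pairing_eq_of_neg ?_ a1 ⟨hm.1, by linarith⟩ ⟨hn.1, by linarith⟩).symm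
    constructor <;> linarith
  · rw [pairing_neg (h.admissible hm) (h.admissible hn) hm.1 hn.1 hs hs',
      pairing_eq_of_neg h.neg (by linarith) (mem_indexSet_neg hm) (mem_indexSet_neg hn),
      normSqFormula_neg]
    simp only [add_left_inj]

theorem integrableOn_Phi_mul_Phi_weight (h : Parameters α β θ) (hm : m ∈ indexSet α β θ)
    (hn : n ∈ indexSet α β θ) :
    IntegrableOn (fun x => Phi α β m x * Phi α β n x * weight α β θ x) (Ioi 0) :=
  integrableOn_Phi_mul_Phi h.abs_alpha (h.admissible hm) (h.admissible hn) h.sin_sum_pos.ne'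

theorem weight_nonneg (h : Parameters α β θ) (hx : 0 < x) : 0 ≤ weight α β θ x := by
  have h1 := h.sin_theta_pos
  have h2 := h.sin_sum_pos
  rw [weight]
  split_ifs with hx1
  · have : 0 < 1 - x := by linarith
    positivity
  · have : 0 ≤ x - 1 := by linarith
    positivity

theorem absolutelyContinuous_weightMeasure :
    weightMeasure α β θ ≪ volume.restrict (Ioi 0) := withDensity_absolutelyContinuous _ _

theorem integrable_weightMeasure_iff (h : Parameters α β θ) {E : Type*} [NormedAddCommGroup E]
    [NormedSpace ℝ E] (f : ℝ → E) :
    Integrable f (weightMeasure α β θ) ↔ IntegrableOn (fun x => weight α β θ x • f x) (Ioi 0) := by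
  rw [weightMeasure, integrable_withDensity_iff_integrable_smul'
    (measurable_weight.ennreal_ofReal) (ae_of_all _ fun _ => ENNReal.ofReal_lt_top)]
  refine integrable_congr ?_
  refine (ae_restrict_iff' measurableSet_Ioi).2 (ae_of_all _ fun x hx => ?_)
  simp only [ENNReal.toReal_ofReal (weight_nonneg h hx)]

theorem integral_weightMeasure (h : Parameters α β θ) {E : Type*} [NormedAddCommGroup E]
    [NormedSpace ℝ E] (f : ℝ → E) :
    ∫ x, f x ∂weightMeasure α β θ = ∫ x in Ioi 0, weight α β θ x • f x := by
  rw [weightMeasure, integral_withDensity_eq_integral_toReal_smul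
    (measurable_weight.ennreal_ofReal) (ae_of_all _ fun _ => ENNReal.ofReal_lt_top)]
  refine setIntegral_congr_fun measurableSet_Ioi fun x hx => ?_
  simp only [ENNReal.toReal_ofReal (weight_nonneg h hx)]

theorem memLp_Phi (h : Parameters α β θ) (hn : n ∈ indexSet α β θ) :
    MemLp (fun x : ℝ => (Phi α β n x : ℂ)) 2 (weightMeasure α β θ) := by
  have hn2 := hn.2
  have hmeas : AEStronglyMeasurable (fun x : ℝ => (Phi α β n x : ℂ)) (weightMeasure α β θ) :=
    Complex.continuous_ofReal.comp_aestronglyMeasurable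
      ((aestronglyMeasurable_Phi h.beta (by linarith)).mono_ac absolutelyContinuous_weightMeasure)
  rw [memLp_two_iff_integrable_sq_norm hmeas, integrable_weightMeasure_iff h]
  refine (integrableOn_Phi_mul_Phi_weight h hn hn).congr_fun (fun x _ => ?_) measurableSet_Ioi
  simp only [Complex.norm_real, Real.norm_eq_abs, sq_abs, smul_eq_mul]
  ring

end

/-! ### A concentrated test function and Hilbert space preliminaries. -/

section

variable {α β θ m n x : ℝ}

/-- A second order form `∫ p f'² - r W f²` takes positive values on test functions with small
support. -/
theorem exists_test_function {p W : ℝ → ℝ} (r : ℝ) (hp : ContinuousOn p (Icc 2 3))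
    (hW : ContinuousOn W (Icc 2 3)) (hpos : ∀ x ∈ Icc (2 : ℝ) 3, 0 < p x) :
    ∃ f : ℝ → ℝ, ContDiff ℝ 2 f ∧ tsupport f ⊆ Ioo 2 3 ∧
      r * ∫ x in (2 : ℝ)..3, W x * f x ^ 2 < ∫ x in (2 : ℝ)..3, p x * deriv f x ^ 2 := by
  have hne : (Icc (2 : ℝ) 3).Nonempty := nonempty_Icc.2 (by norm_num)
  obtain ⟨x₀, hx₀, hmin⟩ := isCompact_Icc.exists_isMinOn hne hp
  obtain ⟨K, hK⟩ := (isCompact_Icc (a := (2 : ℝ)) (b := 3)).exists_bound_of_continuousOn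
    (hW.const_smul r)
  have hK0 : 0 ≤ K := (norm_nonneg _).trans (hK x₀ hx₀)
  set c := p x₀ with hc
  have hc0 : 0 < c := hpos x₀ hx₀
  -- K absorbs r W, one unit pays for completing a square, and one unit is the surplus f² that makes
  -- the final inequality strict.
  set M := K + 2 with hM
  obtain ⟨ε, hε0, hε1, hεM⟩ : ∃ ε : ℝ, 0 < ε ∧ ε ≤ 1 ∧ M ^ 2 * ε ^ 2 ≤ c := by
    refine ⟨min 1 (c / M ^ 2), by positivity, min_le_left _ _, ?_⟩
    have h1 : min 1 (c / M ^ 2) ≤ 1 := min_le_left _ _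
    have h2 : min 1 (c / M ^ 2) ≤ c / M ^ 2 := min_le_right _ _
    have h0 : 0 < min 1 (c / M ^ 2) := by positivity
    have h3 : min 1 (c / M ^ 2) * M ^ 2 ≤ c := (le_div_iff₀ (by positivity)).1 h2
    nlinarith [mul_le_mul_of_nonneg_right h1 (by positivity : 0 ≤ min 1 (c / M ^ 2) * M ^ 2)]
  let φ : ContDiffBump (2 + ε / 2) := ⟨ε / 8, ε / 4, by positivity, by linarith⟩
  have hsupp : tsupport φ ⊆ Ioo 2 (2 + ε) := by
    rw [φ.tsupport_eq, Real.closedBall_eq_Icc]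
    intro x hx
    change x ∈ Icc (2 + ε / 2 - ε / 4) (2 + ε / 2 + ε / 4) at hx
    exact ⟨by linarith [hx.1], by linarith [hx.2]⟩
  set f : ℝ → ℝ := fun x => φ x
  have hf2 : ContDiff ℝ 2 f := φ.contDiff
  have hfd : Differentiable ℝ f := hf2.differentiable (by norm_num)
  have hf' : Continuous (deriv f) := hf2.continuous_deriv (by norm_num)
  have hfc : Continuous f := hf2.continuous
  have h0 (x : ℝ) (hx : x ∉ Ioo 2 (2 + ε)) : f x = 0 := image_eq_zero_of_notMem_tsupport
    fun h => hx (hsupp h)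
  have h0' (x : ℝ) (hx : x ∉ Ioo 2 (2 + ε)) : deriv f x = 0 := image_eq_zero_of_notMem_tsupport
    fun h => hx (hsupp (tsupport_deriv_subset h))
  refine ⟨f, hf2, hsupp.trans (Ioo_subset_Ioo_right (by linarith)), ?_⟩
  have hle : (2 : ℝ) ≤ 3 := by norm_num
  have i1 : IntervalIntegrable (fun x => p x * deriv f x ^ 2) volume 2 3 :=
    ContinuousOn.intervalIntegrable_of_Icc hle (hp.mul (hf'.pow 2).continuousOn)
  have i2 : IntervalIntegrable (fun x => W x * f x ^ 2) volume 2 3 :=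
    ContinuousOn.intervalIntegrable_of_Icc hle (hW.mul (hfc.pow 2).continuousOn)
  have i3 : IntervalIntegrable (fun x => f x ^ 2) volume 2 3 := (hfc.pow 2).intervalIntegrable _ _
  have i4 : IntervalIntegrable (fun x => -M * (f x ^ 2 + (x - 2) * (2 * f x * deriv f x)))
      volume 2 3 := (by fun_prop : Continuous _).intervalIntegrable _ _
  -- A Hardy-type device: the integral of the derivative of −M(x−2)f² is zero and may be added
  -- freely.
  have hzero : ∫ x in (2 : ℝ)..3, -M * (f x ^ 2 + (x - 2) * (2 * f x * deriv f x)) = 0 := by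
    have hd : ∀ x ∈ uIcc (2 : ℝ) 3, HasDerivAt (fun y => -M * ((y - 2) * f y ^ 2))
        (-M * (f x ^ 2 + (x - 2) * (2 * f x * deriv f x))) x := by
      intro x _
      have := ((((hasDerivAt_id x).sub_const 2).mul ((hfd x).hasDerivAt.pow 2)).const_mul (-M))
      refine this.congr_deriv ?_
      simp
    rw [intervalIntegral.integral_eq_sub_of_hasDerivAt hd i4,
      h0 3 (fun h => by linarith [h.2]), h0 2 (fun h => by linarith [h.1])]
    simp
  have hpos' : 0 < ∫ x in (2 : ℝ)..3, f x ^ 2 := by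
    refine intervalIntegral.integral_pos (by norm_num) (hfc.pow 2).continuousOn
      (fun x _ => sq_nonneg _) ⟨2 + ε / 2, ⟨by linarith, by linarith⟩, ?_⟩
    have : f (2 + ε / 2) = 1 := φ.one_of_mem_closedBall (by simp [φ.rIn_pos.le])
    rw [this]
    norm_num
  have key : ∫ x in (2 : ℝ)..3, (f x ^ 2 + -M * (f x ^ 2 + (x - 2) * (2 * f x * deriv f x))) ≤
      ∫ x in (2 : ℝ)..3, (p x * deriv f x ^ 2 - r * (W x * f x ^ 2)) := by
    refine intervalIntegral.integral_mono_on hle (i3.add i4) (i1.sub (i2.const_mul r)) ?_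
    intro x hx
    by_cases hxε : x ∈ Ioo 2 (2 + ε)
    · have hpc : c ≤ p x := hmin hx
      have hrW : r * W x ≤ K := (le_abs_self _).trans (hK x hx)
      have hy : (M * (x - 2)) ^ 2 ≤ c := by
        refine le_trans ?_ hεM
        rw [mul_pow]
        have := hxε.1
        have := hxε.2
        gcongr
        all_goals linarith
      -- On the support p ≥ (M(x−2))², and the square of M(x−2)f' + f being nonnegative gives p f'²
      -- ≥ −2M(x−2)f f' − f².
      nlinarith [mul_nonneg (by linarith : 0 ≤ p x - (M * (x - 2)) ^ 2) (sq_nonneg (deriv f x)),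
        sq_nonneg (M * (x - 2) * deriv f x + f x),
        mul_nonneg (by linarith : 0 ≤ K - r * W x) (sq_nonneg (f x))]
    · rw [h0 x hxε, h0' x hxε]
      simp
  rw [intervalIntegral.integral_add i3 i4, hzero, intervalIntegral.integral_sub i1 (i2.const_mul r),
    intervalIntegral.integral_const_mul] at key
  linarith

theorem inner_toLp (h : Parameters α β θ) {F G : ℝ → ℝ}
    (hF : MemLp (fun x => (F x : ℂ)) 2 (weightMeasure α β θ))
    (hG : MemLp (fun x => (G x : ℂ)) 2 (weightMeasure α β θ)) :
    inner ℂ (hF.toLp _) (hG.toLp _) =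
      ((∫ x in Ioi (0 : ℝ), F x * G x * weight α β θ x : ℝ) : ℂ) := by
  rw [L2.inner_def]
  have : ∀ᵐ x ∂weightMeasure α β θ, inner ℂ (hF.toLp _ x) (hG.toLp _ x) = ((F x * G x : ℝ) : ℂ) := by
    filter_upwards [hF.coeFn_toLp, hG.coeFn_toLp] with x h1 h2
    rw [h1, h2]
    simp [mul_comm]
  rw [integral_congr_ae this, integral_complex_ofReal, integral_weightMeasure h]
  congr 1
  refine setIntegral_congr_fun measurableSet_Ioi fun x _ => ?_
  simp only [smul_eq_mul]
  ring

theorem integral_eq_of_support {F G : ℝ → ℝ} (hG0 : ∀ x ∉ Ioo (2 : ℝ) 3, G x = 0) :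
    ∫ x in Ioi (0 : ℝ), F x * G x * weight α β θ x =
      weightRatio α θ * ∫ x in (2 : ℝ)..3, F x * G x * (x ^ β * (x - 1) ^ α) := by
  rw [intervalIntegral.integral_of_le (by norm_num), ← integral_const_mul,
    setIntegral_eq_of_subset_of_forall_sdiff_eq_zero measurableSet_Ioi (s := Ioc 2 3)
      (fun x hx => by have := hx.1; rw [mem_Ioi]; linarith)
      (fun x hx => by
        rw [hG0 x fun h => hx.2 ⟨h.1, h.2.le⟩]
        simp)]
  refine setIntegral_congr_fun measurableSet_Ioc fun x hx => ?_
  simp only [weight, if_neg (by linarith [hx.1] : ¬ x < 1), weightRatio]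
  ring

theorem memLp_of_continuousOn (h : Parameters α β θ) {F : ℝ → ℝ}
    (hF : ContinuousOn F (Icc 2 3)) (hF0 : ∀ x ∉ Ioo (2 : ℝ) 3, F x = 0) :
    MemLp (fun x => (F x : ℂ)) 2 (weightMeasure α β θ) := by
  have hF0' : (Icc (2 : ℝ) 3).indicator F = F := by
    rw [indicator_eq_self]
    intro x hx
    by_contra hx'
    exact hx (hF0 x fun h => hx' ⟨h.1.le, h.2.le⟩)
  have hmeas : AEStronglyMeasurable F volume := by
    rw [← hF0', aestronglyMeasurable_indicator_iff measurableSet_Icc]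
    exact hF.aestronglyMeasurable measurableSet_Icc
  have hmeas' : AEStronglyMeasurable (fun x : ℝ => (F x : ℂ)) (weightMeasure α β θ) :=
    Complex.continuous_ofReal.comp_aestronglyMeasurable
      (hmeas.restrict.mono_ac absolutelyContinuous_weightMeasure)
  rw [memLp_two_iff_integrable_sq_norm hmeas', integrable_weightMeasure_iff h]
  have hint : IntegrableOn (fun x => weightRatio α θ * (x ^ β * (x - 1) ^ α) * F x ^ 2)
      (Icc 2 3) := by
    refine ContinuousOn.integrableOn_Icc (ContinuousOn.mul (continuousOn_const.mul ?_) (hF.pow 2))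
    refine ContinuousOn.mul (fun x hx => ?_) (fun x hx => ?_)
    · exact (Real.continuousAt_rpow_const _ _ (Or.inl (by linarith [hx.1]))).continuousWithinAt
    · exact (ContinuousAt.rpow_const (by fun_prop)
        (Or.inl (by linarith [hx.1]))).continuousWithinAt
  have hint' := ((integrable_indicator_iff measurableSet_Icc).2 hint).integrableOn (s := Ioi 0)
  refine hint'.congr_fun (fun x hx => ?_) measurableSet_Ioi
  by_cases hx2 : x ∈ Icc (2 : ℝ) 3
  · simp only [indicator_of_mem hx2, weight, if_neg (by linarith [hx2.1] : ¬ x < 1), weightRatio,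
      Complex.norm_real, Real.norm_eq_abs, sq_abs, smul_eq_mul]
  · simp [indicator_of_notMem hx2, hF0 x fun h => hx2 ⟨h.1.le, h.2.le⟩]

theorem normSqFormula_ne_zero (hn : Admissible α β n) : normSqFormula α β n ≠ 0 := by
  obtain ⟨g1, g2, g3, g4, g5, g6, g7, g8⟩ := hn.Gamma_ne_zero
  have h3 := hn.pos₃
  rw [normSqFormula, show 1 + n + α = n + α + 1 by ring, show 1 + n = n + 1 by ring,
    show β + 1 + n = n + β + 1 by ring]
  have : α + β + 2 * n + 1 ≠ 0 := by linarith
  positivity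

/-- The class of `Φ_n` in `L²((0,∞), w dx)`. -/
noncomputable def PhiLp (h : Parameters α β θ) (n : indexSet α β θ) :
    Lp ℂ 2 (weightMeasure α β θ) := (memLp_Phi h n.2).toLp _

theorem inner_PhiLp (h : Parameters α β θ) (m n : indexSet α β θ) :
    inner ℂ (PhiLp h m) (PhiLp h n) =
      if m = n then ((normSqFormula α β n : ℝ) : ℂ) else 0 := by
  have := pairing_eq h m.2 n.2
  rw [PhiLp, PhiLp, inner_toLp h]
  change ((pairing α β θ m n : ℝ) : ℂ) = _
  rw [this]
  simp only [Subtype.ext_iff]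
  split_ifs <;> simp

theorem PhiLp_ne_zero (h : Parameters α β θ) (n : indexSet α β θ) : PhiLp h n ≠ 0 := by
  intro h0
  have := inner_PhiLp h n n
  rw [h0, inner_zero_left, if_pos rfl] at this
  exact normSqFormula_ne_zero (h.admissible n.2) (by exact_mod_cast this.symm)

theorem orthonormal_PhiLp (h : Parameters α β θ) :
    Orthonormal ℂ fun n => ((‖PhiLp h n‖⁻¹ : ℝ) : ℂ) • PhiLp h n := by
  refine ⟨fun n => ?_, fun m n hmn => ?_⟩
  · rw [norm_smul, Complex.norm_real, norm_inv, norm_norm,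
      inv_mul_cancel₀ (norm_ne_zero_iff.2 (PhiLp_ne_zero h n))]
  · simp only [inner_smul_left, inner_smul_right, inner_PhiLp, if_neg hmn, mul_zero]

theorem closedSpan_le (h : Parameters α β θ) : closedSpan α β θ ≤
    (Submodule.span ℂ (range fun n => ((‖PhiLp h n‖⁻¹ : ℝ) : ℂ) • PhiLp h n)).topologicalClosure := by
  refine Submodule.topologicalClosure_mono (Submodule.span_le.2 ?_)
  rintro f ⟨n, hn, hf⟩
  have hfe : f = PhiLp h ⟨n, hn⟩ := by
    have hf' : f =ᵐ[weightMeasure α β θ] fun x => (Phi α β n x : ℂ) := hf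
    exact Lp.ext (hf'.trans (memLp_Phi h hn).coeFn_toLp.symm)
  have hne : ((‖PhiLp h ⟨n, hn⟩‖ : ℝ) : ℂ) ≠ 0 := by
    exact_mod_cast norm_ne_zero_iff.2 (PhiLp_ne_zero h ⟨n, hn⟩)
  have := Submodule.smul_mem _ ((‖PhiLp h ⟨n, hn⟩‖ : ℝ) : ℂ)
    (Submodule.subset_span (R := ℂ) (mem_range_self (f := fun n =>
      ((‖PhiLp h n‖⁻¹ : ℝ) : ℂ) • PhiLp h n) ⟨n, hn⟩))
  rw [smul_smul, Complex.ofReal_inv, mul_inv_cancel₀ hne, one_smul] at this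
  rw [hfe]
  exact this

/-- In a Hilbert space, a vector relation diagonal in a Hilbert basis bounds the quadratic form
from below. -/
theorem re_inner_ge_of_hilbertBasis {ι H : Type*} [NormedAddCommGroup H] [InnerProductSpace ℂ H]
    [CompleteSpace H] (b : HilbertBasis ι ℂ H) {u v : H} {l : ι → ℝ} {r : ℝ} (hr : ∀ i, r ≤ l i)
    (huv : ∀ i, inner ℂ (b i) v = (l i : ℂ) * inner ℂ (b i) u) :
    r * ‖u‖ ^ 2 ≤ (inner ℂ u v).re := by
  -- By Parseval, ⟨u,v⟩ is the sum of l_i |⟨b_i,u⟩|², to be compared with r times the sum for ‖u‖².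
  have h1 := b.hasSum_inner_mul_inner u v
  have h2 := b.hasSum_inner_mul_inner u u
  have e (i : ι) (z : ℂ) : inner ℂ u (b i) * (z * inner ℂ (b i) u) =
      z * ((‖inner ℂ (b i) u‖ ^ 2 : ℝ) : ℂ) := by
    rw [← inner_conj_symm u (b i), mul_left_comm, ← Complex.normSq_eq_conj_mul_self,
      Complex.normSq_eq_norm_sq]
  have h1' : HasSum (fun i => l i * ‖inner ℂ (b i) u‖ ^ 2) (inner ℂ u v).re := by
    convert! Complex.hasSum_re h1 using 1
    ext i
    rw [huv, e, ← Complex.ofReal_mul, Complex.ofReal_re]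
  have h2' : HasSum (fun i => ‖inner ℂ (b i) u‖ ^ 2) (‖u‖ ^ 2) := by
    have := Complex.hasSum_re h2
    rw [inner_self_eq_norm_sq_to_K] at this
    convert! this using 1
    · ext i
      have := e i 1
      rw [one_mul, one_mul] at this
      rw [this, Complex.ofReal_re]
    · norm_cast
  exact hasSum_le (fun i => mul_le_mul_of_nonneg_right (hr i) (sq_nonneg _)) (h2'.mul_left r) h1'

end

/-! ### Incompleteness. -/

section

variable {α β θ m n x : ℝ}

/-- The derivative of `x^{β+1} (x-1)^{α+1} f'`. -/
noncomputable def fluxDeriv (α β : ℝ) (f : ℝ → ℝ) (x : ℝ) : ℝ :=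
  ((β + 1) * x ^ β * (x - 1) ^ (α + 1) + x ^ (β + 1) * ((α + 1) * (x - 1) ^ α)) * deriv f x +
    x ^ (β + 1) * (x - 1) ^ (α + 1) * deriv (deriv f) x

theorem continuousOn_rpow_mul_sub_one_rpow (a b : ℝ) :
    ContinuousOn (fun x : ℝ => x ^ a * (x - 1) ^ b) (Icc 2 3) := by
  refine ContinuousOn.mul (fun x hx => ?_) (fun x hx => ?_)
  · exact (Real.continuousAt_rpow_const _ _ (Or.inl (by linarith [hx.1]))).continuousWithinAt
  · exact (ContinuousAt.rpow_const (by fun_prop) (Or.inl (by linarith [hx.1]))).continuousWithinAt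

theorem hasDerivAt_flux {f : ℝ → ℝ} (hf : ContDiff ℝ 2 f) (hx : 1 < x) :
    HasDerivAt (fun y => y ^ (β + 1) * (y - 1) ^ (α + 1) * deriv f y) (fluxDeriv α β f x) x := by
  have hf' : ContDiff ℝ 1 (deriv f) := hf.deriv'
  have d1 := Real.hasDerivAt_rpow_const (x := x) (p := β + 1) (Or.inl (by linarith))
  have d2 := ((hasDerivAt_id x).sub_const 1).rpow_const (p := α + 1)
    (Or.inl (by simp only [id]; linarith))
  refine ((d1.mul d2).mul (hf'.differentiable one_ne_zero x).hasDerivAt).congr_deriv ?_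
  simp only [fluxDeriv, id, add_sub_cancel_right, Pi.mul_apply]
  ring

theorem continuousOn_fluxDeriv {f : ℝ → ℝ} (hf : ContDiff ℝ 2 f) :
    ContinuousOn (fluxDeriv α β f) (Icc 2 3) := by
  have hf' : ContDiff ℝ 1 (deriv f) := hf.deriv'
  have c1 : Continuous (deriv f) := hf'.continuous
  have c2 : Continuous (deriv (deriv f)) := hf'.continuous_deriv le_rfl
  refine ContinuousOn.add (ContinuousOn.mul (ContinuousOn.add ?_ ?_) c1.continuousOn)
    ((continuousOn_rpow_mul_sub_one_rpow _ _).mul c2.continuousOn)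
  · exact ((continuousOn_rpow_mul_sub_one_rpow β (α + 1)).const_mul (β + 1)).congr
      fun x _ => by ring
  · exact ((continuousOn_rpow_mul_sub_one_rpow (β + 1) α).const_mul (α + 1)).congr
      fun x _ => by ring

/-- Green's formula: the operator moves from f to Φ_n without boundary terms, because f and f'
vanish at 2 and 3. -/
theorem integral_Phi_mul_fluxDeriv {f : ℝ → ℝ} (hf : ContDiff ℝ 2 f) (hsupp : tsupport f ⊆ Ioo 2 3)
    (hn : 0 < 2 * n + α + β + 2) :
    ∫ x in (2 : ℝ)..3, Phi α β n x * fluxDeriv α β f x =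
      eigenvalue α β n * ∫ x in (2 : ℝ)..3, Phi α β n x * f x * (x ^ β * (x - 1) ^ α) := by
  have hle : (2 : ℝ) ≤ 3 := by norm_num
  have hsub : Icc (2 : ℝ) 3 ⊆ Ioi 1 := fun x hx => by have := hx.1; rw [mem_Ioi]; linarith
  have cΦ : ContinuousOn (Phi α β n) (Icc 2 3) := (continuousOn_Phi_right hn).mono hsub
  have i1 : IntervalIntegrable (fun x => Phi α β n x * fluxDeriv α β f x) volume 2 3 :=
    ContinuousOn.intervalIntegrable_of_Icc hle (cΦ.mul (continuousOn_fluxDeriv hf))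
  have i2 : IntervalIntegrable (fun x => Phi α β n x * f x * (x ^ β * (x - 1) ^ α)) volume 2 3 :=
    ContinuousOn.intervalIntegrable_of_Icc hle ((cΦ.mul hf.continuous.continuousOn).mul
      (continuousOn_rpow_mul_sub_one_rpow β α))
  have hd : ∀ x ∈ uIcc (2 : ℝ) 3, HasDerivAt
      (fun y => Phi α β n y * (y ^ (β + 1) * (y - 1) ^ (α + 1) * deriv f y) +
        quasiDerivRight α β n y * f y)
      (Phi α β n x * fluxDeriv α β f x -
        eigenvalue α β n * (Phi α β n x * f x * (x ^ β * (x - 1) ^ α))) x := by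
    intro x hx
    rw [uIcc_of_le hle] at hx
    have hx1 : 1 < x := hsub hx
    obtain ⟨d, hd, e⟩ := hasDerivAt_Phi_right hn hx1
    refine ((hd.mul (hasDerivAt_flux hf hx1)).add ((hasDerivAt_quasiDerivRight hn hx1).mul
      (hf.differentiable two_ne_zero x).hasDerivAt)).congr_deriv ?_
    linear_combination (-deriv f x) * e
  have h0 (x : ℝ) (hx : x ∉ Ioo (2 : ℝ) 3) : f x = 0 ∧ deriv f x = 0 :=
    ⟨image_eq_zero_of_notMem_tsupport fun h => hx (hsupp h),
      image_eq_zero_of_notMem_tsupport fun h => hx (hsupp (tsupport_deriv_subset h))⟩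
  have key := intervalIntegral.integral_eq_sub_of_hasDerivAt hd (i1.sub (i2.const_mul _))
  rw [intervalIntegral.integral_sub i1 (i2.const_mul _), intervalIntegral.integral_const_mul,
    (h0 2 fun h => lt_irrefl _ h.1).1, (h0 2 fun h => lt_irrefl _ h.1).2,
    (h0 3 fun h => lt_irrefl _ h.2).1, (h0 3 fun h => lt_irrefl _ h.2).2] at key
  simp only [mul_zero, add_zero, sub_zero] at key
  linarith

/-- Integration by parts exhibits the unfavourable sign: paired with f itself, the operator with
eigenvalues λ_n is negative on (2,3). -/
theorem integral_self_mul_fluxDeriv {f : ℝ → ℝ} (hf : ContDiff ℝ 2 f)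
    (hsupp : tsupport f ⊆ Ioo 2 3) :
    ∫ x in (2 : ℝ)..3, f x * fluxDeriv α β f x =
      -∫ x in (2 : ℝ)..3, x ^ (β + 1) * (x - 1) ^ (α + 1) * deriv f x ^ 2 := by
  have hle : (2 : ℝ) ≤ 3 := by norm_num
  have i1 : IntervalIntegrable (fun x => f x * fluxDeriv α β f x) volume 2 3 :=
    ContinuousOn.intervalIntegrable_of_Icc hle
      (hf.continuous.continuousOn.mul (continuousOn_fluxDeriv hf))
  have i2 : IntervalIntegrable (fun x => x ^ (β + 1) * (x - 1) ^ (α + 1) * deriv f x ^ 2)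
      volume 2 3 :=
    ContinuousOn.intervalIntegrable_of_Icc hle ((continuousOn_rpow_mul_sub_one_rpow _ _).mul
      ((hf.continuous_deriv (by norm_num)).pow 2).continuousOn)
  have hd : ∀ x ∈ uIcc (2 : ℝ) 3, HasDerivAt
      (fun y => f y * (y ^ (β + 1) * (y - 1) ^ (α + 1) * deriv f y))
      (f x * fluxDeriv α β f x + x ^ (β + 1) * (x - 1) ^ (α + 1) * deriv f x ^ 2) x := by
    intro x hx
    rw [uIcc_of_le hle] at hx
    have hx1 : 1 < x := by linarith [hx.1]
    refine ((hf.differentiable two_ne_zero x).hasDerivAt.mul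
      (hasDerivAt_flux hf hx1)).congr_deriv ?_
    ring
  have h0 (x : ℝ) (hx : x ∉ Ioo (2 : ℝ) 3) : f x = 0 :=
    image_eq_zero_of_notMem_tsupport fun h => hx (hsupp h)
  have key := intervalIntegral.integral_eq_sub_of_hasDerivAt hd (i1.add i2)
  rw [intervalIntegral.integral_add i1 i2, h0 2 fun h => lt_irrefl _ h.1,
    h0 3 fun h => lt_irrefl _ h.2] at key
  simp only [zero_mul, sub_zero] at key
  linarith

theorem le_eigenvalue (α β n : ℝ) : -((α + β + 1) / 2) ^ 2 ≤ eigenvalue α β n := by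
  rw [eigenvalue]
  nlinarith [sq_nonneg (n + (α + β + 1) / 2)]

/-- Completeness would make the normalised Φ_n a Hilbert basis diagonalising the operator on test
functions, so its form would inherit the lower bound −((α+β+1)/2)² of the eigenvalues. -/
theorem closedSpan_ne_top (h : Parameters α β θ) : closedSpan α β θ ≠ ⊤ := by
  intro htop
  have hspan := closedSpan_le h
  rw [htop] at hspan
  let b := HilbertBasis.mk (orthonormal_PhiLp h) hspan
  have hb (n : indexSet α β θ) : b n = ((‖PhiLp h n‖⁻¹ : ℝ) : ℂ) • PhiLp h n := by
    simp only [b, HilbertBasis.coe_mk]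
  obtain ⟨f, hf, hsupp, hlt⟩ := exists_test_function (((α + β + 1) / 2) ^ 2)
    (continuousOn_rpow_mul_sub_one_rpow (β + 1) (α + 1)) (continuousOn_rpow_mul_sub_one_rpow β α)
    (fun x hx => by
      have h1 : 0 < x := by linarith [hx.1]
      have h2 : 0 < x - 1 := by linarith [hx.1]
      positivity)
  have hW (x : ℝ) (hx : x ∈ Icc (2 : ℝ) 3) : 0 < x ^ β * (x - 1) ^ α := by
    have h1 : 0 < x := by linarith [hx.1]
    have h2 : 0 < x - 1 := by linarith [hx.1]
    positivity
  -- The image of f under the Jacobi operator on (1,∞), with sign such that Φ_n has eigenvalue +λ_n.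
  set k : ℝ → ℝ := fun x => fluxDeriv α β f x / (x ^ β * (x - 1) ^ α) with hk
  have hkc : ContinuousOn k (Icc 2 3) := (continuousOn_fluxDeriv hf).div
    (continuousOn_rpow_mul_sub_one_rpow β α) fun x hx => (hW x hx).ne'
  have hf0 (x : ℝ) (hx : x ∉ Ioo (2 : ℝ) 3) : f x = 0 :=
    image_eq_zero_of_notMem_tsupport fun h => hx (hsupp h)
  have hk0 (x : ℝ) (hx : x ∉ Ioo (2 : ℝ) 3) : k x = 0 := by
    have h1 : deriv f x = 0 :=
      image_eq_zero_of_notMem_tsupport fun h => hx (hsupp (tsupport_deriv_subset h))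
    have h2 : deriv (deriv f) x = 0 := image_eq_zero_of_notMem_tsupport fun h =>
      hx (hsupp (tsupport_deriv_subset (tsupport_deriv_subset h)))
    simp only [hk, fluxDeriv, h1, h2, mul_zero, add_zero, zero_div]
  have hkW (F : ℝ → ℝ) : ∫ x in (2 : ℝ)..3, F x * k x * (x ^ β * (x - 1) ^ α) =
      ∫ x in (2 : ℝ)..3, F x * fluxDeriv α β f x := by
    refine intervalIntegral.integral_congr fun x hx => ?_
    rw [uIcc_of_le (by norm_num)] at hx
    simp only [hk]
    rw [mul_assoc, div_mul_cancel₀ _ (hW x hx).ne']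
  have hfm := memLp_of_continuousOn h hf.continuous.continuousOn hf0
  have hkm := memLp_of_continuousOn h hkc hk0
  have hκ : 0 < weightRatio α θ := div_pos h.sin_theta_pos h.sin_sum_pos
  have hdiag (n : indexSet α β θ) : inner ℂ (b n) (hkm.toLp _) =
      ((eigenvalue α β n : ℝ) : ℂ) * inner ℂ (b n) (hfm.toLp _) := by
    have hn2 := n.2.2
    rw [hb, inner_smul_left, inner_smul_left, PhiLp, inner_toLp h, inner_toLp h,
      integral_eq_of_support hk0, integral_eq_of_support hf0, hkW,
      integral_Phi_mul_fluxDeriv hf hsupp (by linarith)]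
    push_cast
    ring
  have hge := re_inner_ge_of_hilbertBasis b (fun n => le_eigenvalue α β n) hdiag
  rw [← Complex.ofReal_re (‖hfm.toLp _‖ ^ 2)] at hge
  have hnorm : ((‖hfm.toLp _‖ ^ 2 : ℝ) : ℂ) = inner ℂ (hfm.toLp _) (hfm.toLp _) := by
    rw [inner_self_eq_norm_sq_to_K]
    norm_cast
  rw [hnorm, inner_toLp h, inner_toLp h, Complex.ofReal_re, Complex.ofReal_re,
    integral_eq_of_support hk0, integral_eq_of_support hf0, hkW,
    integral_self_mul_fluxDeriv hf hsupp] at hge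
  have e : ∫ x in (2 : ℝ)..3, f x * f x * (x ^ β * (x - 1) ^ α) =
      ∫ x in (2 : ℝ)..3, x ^ β * (x - 1) ^ α * f x ^ 2 := by
    refine intervalIntegral.integral_congr fun x _ => ?_
    ring
  rw [e] at hge
  -- The spectral bound gives κ∫p f'² ≤ ((α+β+1)/2)² κ∫W f² with κ the weight ratio, contrary to the
  -- choice of f.
  nlinarith [mul_lt_mul_of_pos_left hlt hκ]

end

end PerturbedJacobi

theorem theoremA6 (α β θ : ℝ) (hα₁ : -1 < α) (hα₂ : α < 1) (hβ : -1 < β)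
    (hθ₀ : 0 < θ) (hθ₁ : θ < 1) (hθα₀ : 0 < θ + α) (hθα₁ : θ + α < 1) :
    (∀ n ∈ PerturbedJacobi.indexSet α β θ,
      MemLp (fun x : ℝ => (PerturbedJacobi.Phi α β n x : ℂ)) 2
        (PerturbedJacobi.weightMeasure α β θ)) ∧
    (∀ m ∈ PerturbedJacobi.indexSet α β θ, ∀ n ∈ PerturbedJacobi.indexSet α β θ, m ≠ n →
      IntegrableOn (fun x : ℝ => PerturbedJacobi.Phi α β m x * PerturbedJacobi.Phi α β n x *
        PerturbedJacobi.weight α β θ x) (Ioi 0) ∧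
      ∫ x in Ioi (0 : ℝ), PerturbedJacobi.Phi α β m x * PerturbedJacobi.Phi α β n x *
        PerturbedJacobi.weight α β θ x = 0) ∧
    (∀ n ∈ PerturbedJacobi.indexSet α β θ,
      IntegrableOn (fun x : ℝ => |PerturbedJacobi.Phi α β n x| ^ 2 *
        PerturbedJacobi.weight α β θ x) (Ioi 0) ∧
      ∫ x in Ioi (0 : ℝ), |PerturbedJacobi.Phi α β n x| ^ 2 *
        PerturbedJacobi.weight α β θ x =
        Real.Gamma (β + 1) ^ 2 * Real.Gamma (1 + n) * Real.Gamma (1 + n + α) /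
          ((α + β + 2 * n + 1) * Real.Gamma (β + 1 + n) * Real.Gamma (n + α + β + 1))) ∧
    PerturbedJacobi.closedSpan α β θ ≠ ⊤ := by
  have h : PerturbedJacobi.Parameters α β θ := ⟨hα₁, hα₂, hβ, hθ₀, hθ₁, hθα₀, hθα₁⟩
  refine ⟨fun n hn => PerturbedJacobi.memLp_Phi h hn, fun m hm n hn hmn =>
    ⟨PerturbedJacobi.integrableOn_Phi_mul_Phi_weight h hm hn, ?_⟩, fun n hn => ?_,
    PerturbedJacobi.closedSpan_ne_top h⟩
  · have := PerturbedJacobi.pairing_eq h hm hn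
    rwa [if_neg hmn] at this
  · have e : ∀ x, |PerturbedJacobi.Phi α β n x| ^ 2 * PerturbedJacobi.weight α β θ x =
        PerturbedJacobi.Phi α β n x * PerturbedJacobi.Phi α β n x *
          PerturbedJacobi.weight α β θ x := fun x => by rw [sq_abs, sq]
    simp only [e]
    refine ⟨PerturbedJacobi.integrableOn_Phi_mul_Phi_weight h hn hn, ?_⟩
    have := PerturbedJacobi.pairing_eq h hn hn
    rwa [if_pos rfl] at this
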